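/- **Model.** A network is a finite connected simple undirected graph in which the edges at each node $v$ of degree $d$ carry distinct port numbers $0,\dots,d-1$ (there is no relation between the port numbers at the two ends of an edge). Nodes are anonymous. Two agents with different positive integer labels start at different nodes and move in synchronous rounds. An adversary wakes up each agent in some round; before its wake-up an agent is dormant at its starting node. In each round an agent that is awake, seeing only the degree of its current node and the port by which it entered this node (taken to be $0$ at the start), either stays idle or tries to leave by a chosen port. The adversary may block an attempted move (a fault); then the agent stays at its node and is aware of the fault. Each agent incurs faults in at most $c$ consecutive rounds, where $c\ge 1$ is unknown to the agents. Rendezvous occurs when both agents are at the same node in the same round (the other agent may still be dormant; agents that cross inside an edge do not meet). The execution time is the number of rounds from the wake-up of the first agent until rendezvous. **Exploration sequences.** Following a sequence $x_0,\dots,x_{u-1}$ of nonnegative integers means to leave, in step $k$, the current node of degree $d$, entered by port $p$, through port $(p+x_k)\bmod d$. The algorithm uses, for each $u$, a fixed sequence $S_u$ of length $u$. We say that length $P(n)$ suffices for size $n$ if, for every $n$ and every $u\ge P(n)$, following $S_u$ traverses all edges of every connected port-numbered graph with at most $n$ nodes, from every starting node and every port of entry there. If this holds, $(S_u)_u$ is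 called a family of universal exploration sequences with length function $P$. **Algorithm Graph-RV-BF** (agent with label $\lambda$). Let $q=\lceil\log_2(\lambda+1)\rceil$, $u_q=1$, $c_q=2^q$. The algorithm runs through phases $i=0,1,2,\dots$; phase $i$ consists of $2^i$ stages, numbered $0,\dots,2^i-1$, of $2^{i+4}$ rounds each. The agent is idle in all stages except stage $\lambda$ of each phase $i\ge q$. This stage begins with a busy part of $3\cdot 2^i$ rounds, consisting of three explorations of $2^i=u_ic_i$ rounds each, and the agent is idle in its remaining $13\cdot 2^i$ rounds. In an exploration the agent performs steps $k=0,\dots,u_i-1$ of $c_i$ rounds each: in step $k$ it tries to leave by port $(p+S_{u_i}[k])\bmod d$, where $d$ is the degree of the current node and $p$ the port by which it was entered, until it succeeds or the $c_i$ rounds are over; after a success it is idle until the end of the step. If it does not succeed within the step, the exploration has failed and the agent is idle until the end of this exploration. If all three explorations succeed, then $u_{i+1}=2u_i$ and $c_{i+1}=c_i$; otherwise $u_{i+1}=u_i$ and $c_{i+1}=2c_i$. **Theorem.** Let $n$ be the number of nodes, $c\ge1$ the fault bound and $L$ the larger label. 1. There is an absolute constant $K$ such that, for every family $(S_u)_u$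 of universal exploration sequences with any length function $P$, Algorithm Graph-RV-BF using $(S_u)_u$ always achieves rendezvous, in time at most $K\,(P(n)\cdot c\cdot L)^2$, for all graphs, starting nodes, labels, wake-up rounds and faults that respect the fault bound $c$. 2. If the length function $P$ is a polynomial (with nonnegative integer coefficients), then Algorithm Graph-RV-BF always achieves rendezvous, in time at most $Q(n,c,L)$ for some polynomial $Q$. 3. Families of universal exploration sequences with a polynomial length function exist. -/

import Mathlib

/-! ## Networks: anonymous port-numbered graphs -/

/-- A simple undirected graph with a local port numbering. The edges at `v` carry the port numbers
`0, …, deg v - 1` (so `deg v` is the degree of `v`); `port v q` is the neighbour of `v` reached by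
leaving `v` through port `q`. -/
structure PortGraph (V : Type) where
  graph : SimpleGraph V
  deg : V → ℕ
  port : ∀ v : V, Fin (deg v) ≃ graph.neighborSet v

/-- Leaving node `v` (entered by port `p`) through port `q`: the new node together with the port by
which it is entered. If `v` has no port `q`, nothing changes. -/
def PortGraph.cross {V : Type} (G : PortGraph V) (s : V × ℕ) (q : ℕ) : V × ℕ :=
  if h : q < G.deg s.1 then
    (((G.port s.1 ⟨q, h⟩ : G.graph.neighborSet s.1) : V),
      ((G.port (G.port s.1 ⟨q, h⟩ : G.graph.neighborSet s.1)).symm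
        ⟨s.1, G.graph.adj_symm (G.port s.1 ⟨q, h⟩).2⟩ : ℕ))
  else s

/-! ## Universal exploration sequences -/

/-- The walk (node and port of entry) prescribed by the sequence `x`: a node of degree `d` that was
entered by port `p` is left in step `k` by port `(p + x k) mod d`. -/
def PortGraph.uxsWalk {V : Type} (G : PortGraph V) (x : ℕ → ℕ) (s : V × ℕ) : ℕ → V × ℕ
  | 0 => s
  | k + 1 =>
    G.cross (G.uxsWalk x s k) (((G.uxsWalk x s k).2 + x k) % G.deg (G.uxsWalk x s k).1)

/-- The first `u` terms of `x` are a universal exploration sequence for graphs of size at most `n`: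
in every connected port-numbered graph with at most `n` nodes, from every starting node and every
port of entry there, the walk prescribed by these terms traverses all edges. -/
def IsUXS (x : ℕ → ℕ) (u n : ℕ) : Prop :=
  ∀ (V : Type) [Fintype V] (G : PortGraph V), G.graph.Connected → Fintype.card V ≤ n →
    ∀ (v : V) (p : ℕ), p < G.deg v →
      ∀ y z : V, G.graph.Adj y z → ∃ k < u,
        ((G.uxsWalk x (v, p) k).1 = y ∧ (G.uxsWalk x (v, p) (k + 1)).1 = z) ∨
        ((G.uxsWalk x (v, p) k).1 = z ∧ (G.uxsWalk x (v, p) (k + 1)).1 = y)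

/-- `S u` (restricted to its first `u` terms) is the sequence of length `u` that the agents use.
Length `P n` suffices to traverse all edges of any graph of size at most `n`. -/
def IsUXSFamily (S : ℕ → ℕ → ℕ) (P : ℕ → ℕ) : Prop :=
  ∀ n u : ℕ, P n ≤ u → IsUXS (S u) u n

/-! ## Agents and delay faults -/

/-- A deterministic algorithm of an agent with memory states in `M`. In each round it sees only the
degree of the current node and the port by which this node was entered (in this order). `act` is the
decision: `none` to remain idle, `some q` to try to leave by port `q`. At the end of the round the
memory is updated by `next`, whose last argument tells whether the agent has moved. -/
structure AgentAlgorithm (M : Type) where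
  init : ℕ → M
  act : M → ℕ → ℕ → Option ℕ
  next : M → ℕ → ℕ → Bool → M

/-- Everything that the adversary chooses for one agent: its label, its starting node, the round in
which it is woken up, and the rounds in which a move that it attempts is blocked. -/
structure AgentSetup (V : Type) where
  label : ℕ
  start : V
  wake : ℕ
  fault : ℕ → Bool

/-- Current node, port by which it was entered, memory. -/
structure AgentConfig (V M : Type) where
  node : V
  entry : ℕ
  mem : M

namespace AgentAlgorithm

variable {V M : Type}

/-- One round of an agent that is awake; `fault` tells whether a move is blocked in this round. -/
def round (A : AgentAlgorithm M) (G : PortGraph V) (s : AgentConfig V M) (fault : Bool) :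
    AgentConfig V M :=
  match A.act s.mem (G.deg s.node) s.entry with
  | none => ⟨s.node, s.entry, A.next s.mem (G.deg s.node) s.entry false⟩
  | some q =>
    if fault then ⟨s.node, s.entry, A.next s.mem (G.deg s.node) s.entry false⟩
    else ⟨(G.cross (s.node, s.entry) q).1, (G.cross (s.node, s.entry) q).2,
      A.next s.mem (G.deg s.node) s.entry true⟩

/-- The configuration of an agent at the beginning of (global) round `t`. Before its wake-up the
agent is dormant at its starting node. The port of entry of the starting node is `0` by convention. -/
def config (A : AgentAlgorithm M) (G : PortGraph V) (a : AgentSetup V) : ℕ → AgentConfig V M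
  | 0 => ⟨a.start, 0, A.init a.label⟩
  | t + 1 =>
    if t < a.wake then A.config G a t else A.round G (A.config G a t) (a.fault t)

/-- The agent incurs a fault in round `t`: it is awake, it decides to move, and it is delayed. -/
def IncursFault (A : AgentAlgorithm M) (G : PortGraph V) (a : AgentSetup V) (t : ℕ) : Prop :=
  a.wake ≤ t ∧
  (A.act (A.config G a t).mem (G.deg (A.config G a t).node) (A.config G a t).entry).isSome ∧
  a.fault t = true

/-- The adversary delays the agent for at most `c` consecutive rounds. -/
def FaultBound (A : AgentAlgorithm M) (G : PortGraph V) (a : AgentSetup V) (c : ℕ) : Prop :=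
  ∀ t : ℕ, ¬ ∀ s : ℕ, t ≤ s → s ≤ t + c → A.IncursFault G a s

/-- `τ` is the number of rounds from the wake-up of the first agent until the agents are, for the
first time, at the same node. (Agents that cross each other inside an edge do not meet.) -/
def IsRendezvousTime (A : AgentAlgorithm M) (G : PortGraph V) (a b : AgentSetup V) (τ : ℕ) : Prop :=
  IsLeast {t : ℕ | (A.config G a (min a.wake b.wake + t)).node =
    (A.config G b (min a.wake b.wake + t)).node} τ

/-- Two agents with different positive labels that execute `A`, starting at different nodes of a
connected graph of size `n`, with wake-up rounds and faults chosen by the adversary with fault bound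
`c`, always meet, at most `f n c L` rounds after the first wake-up; `L` is the larger label. -/
def WorksInTime (A : AgentAlgorithm M) (f : ℕ → ℕ → ℕ → ℕ) : Prop :=
  ∀ (V : Type) [Fintype V] (G : PortGraph V), G.graph.Connected →
    ∀ (c : ℕ), 0 < c → ∀ a b : AgentSetup V,
      a.start ≠ b.start → 0 < a.label → 0 < b.label → a.label ≠ b.label →
      A.FaultBound G a c → A.FaultBound G b c →
      ∃ τ : ℕ, A.IsRendezvousTime G a b τ ∧ τ ≤ f (Fintype.card V) c (max a.label b.label)

end AgentAlgorithm

/-! ## Algorithm Graph-RV-BF -/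

/-- Memory of an agent that executes Graph-RV-BF. Phase `i` has `2 ^ i` stages of `2 ^ (i + 4)`
rounds. `phase` is the current phase and `round` counts the rounds since its beginning; `u` and `c`
are the current estimates; `success` tells whether no step of the current busy part has failed so
far; `moved` whether the agent has already moved in the current step of the exploration; `aborted`
whether the current exploration has been broken off after a failed step. -/
structure BFMem where
  label : ℕ
  phase : ℕ
  round : ℕ
  u : ℕ
  c : ℕ
  success : Bool
  moved : Bool
  aborted : Bool

namespace BFMem

/-- Initially `u = 1` and `c = 2 ^ q` with `q = ⌈log₂ (label + 1)⌉`. -/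
def start (label : ℕ) : BFMem :=
  ⟨label, 0, 0, 1, 2 ^ Nat.clog 2 (label + 1), true, false, false⟩

/-- Index of the current stage in the current phase. -/
def stage (m : BFMem) : ℕ := m.round / 2 ^ (m.phase + 4)

/-- Number of rounds since the beginning of the current stage. -/
def stageRound (m : BFMem) : ℕ := m.round % 2 ^ (m.phase + 4)

/-- The busy part consists of the first `3 * 2 ^ phase` rounds of the stage whose index is the
label: three explorations of `2 ^ phase` rounds each. -/
def Busy (m : BFMem) : Prop := m.stage = m.label ∧ m.stageRound < 3 * 2 ^ m.phase

instance (m : BFMem) : Decidable m.Busy := by unfold Busy; infer_instance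

/-- In a busy part: number of rounds since the beginning of the current exploration. -/
def expRound (m : BFMem) : ℕ := m.stageRound % 2 ^ m.phase

/-- At the end of the `c` rounds of a step: if the agent has not moved during the step, then the
exploration is broken off and has failed. -/
def endStep (m : BFMem) : BFMem :=
  if (m.expRound + 1) % m.c = 0 then
    { m with
      success := m.success && m.moved
      aborted := m.aborted || !m.moved
      moved := false }
  else m

/-- At the end of the `2 ^ phase` rounds of an exploration. -/
def endExploration (m : BFMem) : BFMem :=
  if m.expRound + 1 = 2 ^ m.phase then { m with aborted := false } else m

/-- At the end of the busy part: `u` is doubled if all three explorations were successful, and `c`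
is doubled otherwise. -/
def endBusy (m : BFMem) : BFMem :=
  if m.stageRound + 1 = 3 * 2 ^ m.phase then
    if m.success then { m with u := 2 * m.u } else { m with c := 2 * m.c, success := true }
  else m

/-- Advance the clock by one round; phase `i` lasts `2 ^ (2 * i + 4)` rounds. -/
def tick (m : BFMem) : BFMem :=
  if m.round + 1 = 2 ^ (2 * m.phase + 4) then { m with phase := m.phase + 1, round := 0 }
  else { m with round := m.round + 1 }

/-- The memory after a round in which the agent has moved (`ok = true`) or not (`ok = false`). -/
def update (m : BFMem) (ok : Bool) : BFMem :=
  if m.Busy then ({ m with moved := m.moved || ok }.endStep.endExploration.endBusy).tick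
  else m.tick

end BFMem

/-- Algorithm Graph-RV-BF with the exploration sequences `S`. In a busy part, unless the current
exploration is broken off, the agent performs the steps `k = 0, …, u - 1` of the sequence `S u`, each
lasting `c` rounds: it tries to leave by port `(p + S u k) mod d` until it succeeds, and then waits
until the end of the step. In all other rounds it is idle. -/
def graphRVBF (S : ℕ → ℕ → ℕ) : AgentAlgorithm BFMem where
  init := BFMem.start
  act m d p :=
    if m.Busy ∧ m.moved = false ∧ m.aborted = false then
      some ((p + S m.u (m.expRound / m.c)) % d)
    else none
  next m _ _ ok := m.update ok

/-!
Rendezvous time. In a phase with a busy part the agent either performs three successful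
explorations and doubles `u`, or meets a step in which all `c` attempts are blocked; the latter
requires `c` not to exceed the fault bound (`graphRVBF.config_phase`). Hence the estimate stays
`O(c L)` (in which `c` is the fault bound), and since the two estimates have the product `2 ^ i`
in phase `i`, every value `u = 2 ^ k` up to a constant multiple of `2 ^ i / (c L)` has been used
in a successful phase (`graphRVBF.exists_estimates`). If `2 ^ k ≥ P n`, such a phase leads to
rendezvous unless the other agent moves during its first exploration, which is possible only if
the busy parts of phase `i` of the agent woken up first and of some phase `j` of the other agent
overlap (`graphRVBF.Explores.meet_or_clash`). Phases have length `16 * 4 ^ i`, so `j ≤ i`, and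
each of the cases `j = i`, `j = i - 1`, `j ≤ i - 2` can occur for one `i` only (`Clash.not_lt`):
up to `O(2 ^ i)`, an overlap determines the delay `δ` between the wake-ups, as `16 * 2 ^ i` times
the nonzero difference of the labels in the first case, and as a quantity of order `4 ^ i` in the
other ones; in each case two phases give incompatible values. So one of four successive values of
`u` works, and the phase in which it is used satisfies `2 ^ i = O(P n * c * L)`, while all phases
up to it take `O(4 ^ i)` rounds.

Universal exploration sequences. The expected time between two traversals of a dart by the simple
random walk is the number of darts. This is proved without limits, for times truncated at `T`, by
summing the one-step equation over all nodes (`sum_hitTime_le`). With the triangle inequality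
`hitTime_le_add` along a path it follows that a random walk traverses a given dart in expected
time `O(n ^ 3)` (`hitTime_le`), so the probability of missing it for `4 * n ^ 3 * r` steps is at
most `2 ^ (-r)` (`survival_le`). A term that is uniform in the range `n !` makes each step of the
prescribed walk uniform at every node, so the method of conditional expectations
(`TraversalTask.exists_sequence`) yields one sequence for all graphs at once, as soon as `2 ^ r`
exceeds the number of graphs with starting point and dart, which is `2 ^ O(n ^ 3)`.
-/

/-! ### The clock of an agent and its busy parts -/

/-- Number of rounds before phase `i`. -/
def phaseStart : ℕ → ℕ
  | 0 => 0
  | i + 1 => phaseStart i + 2 ^ (2 * i + 4)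

/-- Number of rounds, counted from the wake-up, before the busy part of phase `i` of the agent with
label `l`. -/
def busyStart (l i : ℕ) : ℕ := phaseStart i + 2 ^ (i + 4) * l

theorem three_mul_phaseStart (i : ℕ) : 3 * phaseStart i + 16 = 16 * (2 ^ i * 2 ^ i) := by
  induction i with
  | zero => simp [phaseStart]
  | succ i ih =>
    have h : 2 ^ (2 * i + 4) = 16 * (2 ^ i * 2 ^ i) := by ring
    rw [phaseStart, h, pow_succ]
    linarith

theorem phaseStart_mono : Monotone phaseStart :=
  monotone_nat_of_le_succ fun i => Nat.le_add_right _ (2 ^ (2 * i + 4))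

/-- A busy part lies inside its phase. -/
theorem busyPart_le {l i x : ℕ} (hl : l < 2 ^ i) (hx : x ≤ 3 * 2 ^ i) :
    2 ^ (i + 4) * l + x < 2 ^ (2 * i + 4) := by
  have h : 2 ^ (2 * i + 4) = 2 ^ (i + 4) * 2 ^ i := by ring
  have h' : 2 ^ (i + 4) = 16 * 2 ^ i := by ring
  have h1 : 2 ^ (i + 4) * (l + 1) ≤ 2 ^ (i + 4) * 2 ^ i := Nat.mul_le_mul_left _ hl
  have h2 : 0 < 2 ^ i := by positivity
  rw [h]
  rw [mul_add, mul_one] at h1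
  omega

namespace BFMem

theorem tick_eq {m : BFMem} (h : m.round + 1 < 2 ^ (2 * m.phase + 4)) :
    m.tick = { m with round := m.round + 1 } := by
  rw [tick, if_neg h.ne]

theorem endStep_clock (m : BFMem) :
    m.endStep.label = m.label ∧ m.endStep.phase = m.phase ∧ m.endStep.round = m.round := by
  unfold endStep; split_ifs <;> simp

theorem endExploration_clock (m : BFMem) :
    m.endExploration.label = m.label ∧ m.endExploration.phase = m.phase ∧
      m.endExploration.round = m.round := by
  unfold endExploration; split_ifs <;> simp

theorem endBusy_clock (m : BFMem) :
    m.endBusy.label = m.label ∧ m.endBusy.phase = m.phase ∧ m.endBusy.round = m.round := by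
  unfold endBusy; split_ifs <;> simp

theorem tick_clock {m m' : BFMem} (h : m'.label = m.label ∧ m'.phase = m.phase ∧ m'.round = m.round) :
    m'.tick.label = m.tick.label ∧ m'.tick.phase = m.tick.phase ∧ m'.tick.round = m.tick.round := by
  obtain ⟨h1, h2, h3⟩ := h
  unfold tick
  rw [h2, h3]
  split_ifs <;> simp [h1]

/-- Label, phase and round evolve independently of what happens to the agent. -/
theorem update_clock (m : BFMem) (ok : Bool) :
    (m.update ok).label = m.tick.label ∧ (m.update ok).phase = m.tick.phase ∧
      (m.update ok).round = m.tick.round := by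
  unfold update
  split_ifs
  · apply tick_clock
    have h1 := endStep_clock { m with moved := m.moved || ok }
    have h2 := endExploration_clock ({ m with moved := m.moved || ok } : BFMem).endStep
    have h3 := endBusy_clock ({ m with moved := m.moved || ok } : BFMem).endStep.endExploration
    simp_all
  · simp

/-- The rounds of the busy part of phase `i`. -/
theorem busy_iff (m : BFMem) :
    m.Busy ↔ ∃ x < 3 * 2 ^ m.phase, m.round = 2 ^ (m.phase + 4) * m.label + x := by
  have h' : 2 ^ (m.phase + 4) = 16 * 2 ^ m.phase := by ring
  have h0 : 0 < 2 ^ m.phase := by positivity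
  unfold Busy stage stageRound
  constructor
  · rintro ⟨h1, h2⟩
    exact ⟨_, h2, by rw [← h1]; exact (Nat.div_add_mod _ _).symm⟩
  · rintro ⟨x, hx, h⟩
    rw [h, Nat.mul_add_div (by positivity), Nat.mul_add_mod, Nat.div_eq_of_lt (by omega),
      Nat.mod_eq_of_lt (by omega)]
    exact ⟨by simp, hx⟩

end BFMem

namespace AgentAlgorithm

variable {V M : Type}

theorem config_succ (A : AgentAlgorithm M) (G : PortGraph V) {a : AgentSetup V} {t : ℕ}
    (h : a.wake ≤ t) : A.config G a (t + 1) = A.round G (A.config G a t) (a.fault t) := by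
  rw [config, if_neg h.not_gt]

theorem config_of_le_wake (A : AgentAlgorithm M) (G : PortGraph V) {a : AgentSetup V} {t : ℕ}
    (h : t ≤ a.wake) : A.config G a t = ⟨a.start, 0, A.init a.label⟩ := by
  induction t with
  | zero => rfl
  | succ t ih => rw [config, if_pos (Nat.lt_of_succ_le h), ih (by omega)]

theorem round_mem (A : AgentAlgorithm M) (G : PortGraph V) (s : AgentConfig V M) (b : Bool) :
    ∃ ok, (A.round G s b).mem = A.next s.mem (G.deg s.node) s.entry ok := by
  unfold round
  split
  · exact ⟨_, rfl⟩
  · split_ifs <;> exact ⟨_, rfl⟩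

theorem round_of_act_none {A : AgentAlgorithm M} {G : PortGraph V} {s : AgentConfig V M} (b : Bool)
    (h : A.act s.mem (G.deg s.node) s.entry = none) :
    A.round G s b = ⟨s.node, s.entry, A.next s.mem (G.deg s.node) s.entry false⟩ := by
  unfold round
  rw [h]

end AgentAlgorithm

theorem PortGraph.cross_lt {V : Type} (G : PortGraph V) {s : V × ℕ} (hs : s.2 < G.deg s.1) (q : ℕ) :
    (G.cross s q).2 < G.deg (G.cross s q).1 := by
  unfold PortGraph.cross
  split_ifs
  · exact Fin.is_lt _
  · exact hs

/-- The port of entry is always a port of the current node, if there are no isolated nodes. -/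
theorem AgentAlgorithm.entry_lt {V M : Type} (A : AgentAlgorithm M) (G : PortGraph V)
    (a : AgentSetup V) (hG : ∀ v, 0 < G.deg v) (t : ℕ) :
    (A.config G a t).entry < G.deg (A.config G a t).node := by
  induction t with
  | zero => exact hG _
  | succ t ih =>
    rw [AgentAlgorithm.config]
    split_ifs
    · exact ih
    · unfold AgentAlgorithm.round
      split
      · exact ih
      · split_ifs
        · exact ih
        · exact G.cross_lt (s := ((A.config G a t).node, (A.config G a t).entry)) ih _

namespace graphRVBF

variable {V : Type} {S : ℕ → ℕ → ℕ} {G : PortGraph V} {a : AgentSetup V}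

/-- The clock of an agent that is awake. -/
theorem clock (S : ℕ → ℕ → ℕ) (G : PortGraph V) (a : AgentSetup V) {t : ℕ} (ht : a.wake ≤ t) :
    ((graphRVBF S).config G a t).mem.label = a.label ∧
    t = a.wake + phaseStart ((graphRVBF S).config G a t).mem.phase +
      ((graphRVBF S).config G a t).mem.round ∧
    ((graphRVBF S).config G a t).mem.round <
      2 ^ (2 * ((graphRVBF S).config G a t).mem.phase + 4) := by
  induction t, ht using Nat.le_induction with
  | base =>
    rw [AgentAlgorithm.config_of_le_wake _ _ le_rfl]
    simp [graphRVBF, BFMem.start, phaseStart]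
  | succ t ht ih =>
    rw [AgentAlgorithm.config_succ _ _ ht]
    obtain ⟨ok, hok⟩ := (graphRVBF S).round_mem G ((graphRVBF S).config G a t) (a.fault t)
    rw [hok]
    generalize ((graphRVBF S).config G a t).mem = m at ih
    obtain ⟨h1, h2, h3⟩ := ih
    obtain ⟨k1, k2, k3⟩ := m.update_clock ok
    change (m.update ok).label = _ ∧ _ = _ + phaseStart (m.update ok).phase + (m.update ok).round ∧
      (m.update ok).round < 2 ^ (2 * (m.update ok).phase + 4)
    rw [k1, k2, k3]
    unfold BFMem.tick
    split_ifs with h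
    · refine ⟨h1, ?_, by positivity⟩
      simp only [phaseStart]
      omega
    · refine ⟨h1, ?_, ?_⟩ <;> dsimp only <;> omega

theorem act_of_not_busy {m : BFMem} (h : ¬ m.Busy) (d p : ℕ) : (graphRVBF S).act m d p = none := by
  simp [graphRVBF, h]

/-- An agent changes its node only in busy parts. -/
theorem exists_busy_of_node_ne {t : ℕ}
    (h : ((graphRVBF S).config G a (t + 1)).node ≠ ((graphRVBF S).config G a t).node) :
    ∃ j, a.label < 2 ^ j ∧ ∃ y < 3 * 2 ^ j, t = a.wake + busyStart a.label j + y := by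
  have ht : a.wake ≤ t := by
    by_contra hlt
    rw [AgentAlgorithm.config, if_pos (not_le.mp hlt)] at h
    exact h rfl
  obtain ⟨h1, h2, h3⟩ := clock S G a ht
  rw [AgentAlgorithm.config_succ _ _ ht] at h
  have hb : ((graphRVBF S).config G a t).mem.Busy := by
    by_contra hb
    rw [AgentAlgorithm.round_of_act_none _ (act_of_not_busy hb _ _)] at h
    exact h rfl
  obtain ⟨x, hx, hr⟩ := (BFMem.busy_iff _).mp hb
  refine ⟨_, ?_, x, hx, ?_⟩
  · rw [hr, h1] at h3
    have : 2 ^ (2 * ((graphRVBF S).config G a t).mem.phase + 4) =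
      2 ^ (((graphRVBF S).config G a t).mem.phase + 4) *
        2 ^ ((graphRVBF S).config G a t).mem.phase := by ring
    rw [this] at h3
    exact Nat.lt_of_mul_lt_mul_left (lt_of_le_of_lt (Nat.le_add_right _ _) h3)
  · rw [hr, h1] at h2
    rw [busyStart]
    omega

/-- Idle rounds only advance the clock. -/
theorem config_idle {t l i r u c : ℕ} {v : V} {p : ℕ} {su mv ab : Bool} (ht : a.wake ≤ t)
    (hcfg : (graphRVBF S).config G a t = ⟨v, p, ⟨l, i, r, u, c, su, mv, ab⟩⟩) (k : ℕ)
    (hk : r + k < 2 ^ (2 * i + 4))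
    (hidle : ∀ x, r ≤ x → x < r + k → ¬ BFMem.Busy ⟨l, i, x, u, c, su, mv, ab⟩) :
    (graphRVBF S).config G a (t + k) = ⟨v, p, ⟨l, i, r + k, u, c, su, mv, ab⟩⟩ := by
  induction k with
  | zero => exact hcfg
  | succ k ih =>
    have hnb := hidle (r + k) (by omega) (by omega)
    rw [← add_assoc, AgentAlgorithm.config_succ _ _ (by omega),
      ih (by omega) (fun x h1 h2 => hidle x h1 (by omega)),
      AgentAlgorithm.round_of_act_none _ (act_of_not_busy hnb _ _)]
    change AgentConfig.mk v p (BFMem.update _ false) = _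
    rw [BFMem.update, if_neg hnb, BFMem.tick_eq (by dsimp only; omega)]
    rfl

/-- Idle rounds at the end of a phase. -/
theorem config_idle_to_next {t l i r u c : ℕ} {v : V} {p : ℕ} {su mv ab : Bool} (ht : a.wake ≤ t)
    (hcfg : (graphRVBF S).config G a t = ⟨v, p, ⟨l, i, r, u, c, su, mv, ab⟩⟩) (k : ℕ)
    (hk : r + (k + 1) = 2 ^ (2 * i + 4))
    (hidle : ∀ x, r ≤ x → x < 2 ^ (2 * i + 4) → ¬ BFMem.Busy ⟨l, i, x, u, c, su, mv, ab⟩) :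
    (graphRVBF S).config G a (t + (k + 1)) = ⟨v, p, ⟨l, i + 1, 0, u, c, su, mv, ab⟩⟩ := by
  have hnb := hidle (r + k) (by omega) (by omega)
  rw [← add_assoc, AgentAlgorithm.config_succ _ _ (by omega),
    config_idle ht hcfg k (by omega) (fun x h1 _ => hidle x h1 (by omega)),
    AgentAlgorithm.round_of_act_none _ (act_of_not_busy hnb _ _)]
  change AgentConfig.mk v p (BFMem.update _ false) = _
  rw [BFMem.update, if_neg hnb, BFMem.tick, if_pos (by dsimp only; omega)]

end graphRVBF

/-! ### The busy part of a phase -/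

namespace graphRVBF

variable {V : Type} {S : ℕ → ℕ → ℕ} {G : PortGraph V} {a : AgentSetup V}

/-- The situation within a step that started in round `t₀` at node `v` entered by port `p`, with
`q` the port to be taken: either the agent is still there, all its attempts having been blocked
(if it made any, that is, if the exploration has not been broken off), or it has crossed the edge. -/
def StepInv (S : ℕ → ℕ → ℕ) (G : PortGraph V) (a : AgentSetup V) (v : V) (p q : ℕ) (ab : Bool)
    (t₀ t : ℕ) (v' : V) (p' : ℕ) (mv : Bool) : Prop :=
  (mv = false ∧ v' = v ∧ p' = p ∧
    (ab = false → ∀ s, t₀ ≤ s → s < t → (graphRVBF S).IncursFault G a s)) ∨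
  (mv = true ∧ ab = false ∧ (v', p') = G.cross (v, p) q)

/-- One round of a step. -/
theorem StepInv.round {v v' : V} {p p' q t₀ t : ℕ} {ab : Bool} {m : BFMem} (ht : a.wake ≤ t)
    (hcfg : (graphRVBF S).config G a t = ⟨v', p', m⟩) (hb : m.Busy) (hab : m.aborted = ab)
    (hq : q = (p + S m.u (m.expRound / m.c)) % G.deg v)
    (h : StepInv S G a v p q ab t₀ t v' p' m.moved) :
    ∃ v'' p'' ok, (graphRVBF S).config G a (t + 1) = ⟨v'', p'', m.update ok⟩ ∧
      StepInv S G a v p q ab t₀ (t + 1) v'' p'' (m.moved || ok) := by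
  rw [AgentAlgorithm.config_succ _ _ ht, hcfg]
  rcases h with ⟨hmv, rfl, rfl, hf⟩ | ⟨hmv, hab', hcross⟩
  · cases ab with
    | true =>
      have hact : (graphRVBF S).act m (G.deg v') p' = none := by simp [graphRVBF, hab]
      rw [AgentAlgorithm.round_of_act_none _ hact]
      exact ⟨_, _, false, rfl, Or.inl ⟨by simp [hmv], rfl, rfl, by simp⟩⟩
    | false =>
      have hact : (graphRVBF S).act m (G.deg v') p' = some q := by
        simp [graphRVBF, hab, hb, hmv, hq]
      unfold AgentAlgorithm.round
      simp only [hact]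
      cases hfault : a.fault t with
      | true =>
        refine ⟨v', p', false, rfl, Or.inl ⟨by simp [hmv], rfl, rfl, fun _ s h1 h2 => ?_⟩⟩
        rcases Nat.lt_succ_iff_lt_or_eq.mp h2 with h2 | rfl
        · exact hf rfl s h1 h2
        · exact ⟨ht, by simp [hcfg, hact], hfault⟩
      | false =>
        exact ⟨_, _, true, rfl, Or.inr ⟨by simp, rfl, rfl⟩⟩
  · have hact : (graphRVBF S).act m (G.deg v') p' = none := by simp [graphRVBF, hmv]
    rw [AgentAlgorithm.round_of_act_none _ hact]
    exact ⟨_, _, false, rfl, Or.inr ⟨by simp [hmv], hab', hcross⟩⟩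

variable {l i u c : ℕ}

theorem stageRound_mk {x : ℕ} (hx : x < 3 * 2 ^ i) {su mv ab : Bool} :
    (BFMem.mk l i (2 ^ (i + 4) * l + x) u c su mv ab).stageRound = x := by
  have h' : 2 ^ (i + 4) = 16 * 2 ^ i := by ring
  simp only [BFMem.stageRound]
  rw [Nat.mul_add_mod, Nat.mod_eq_of_lt (by omega)]

/-- Position within an exploration: round `y` of step `k` (counted through all explorations). -/
theorem expRound_mk {k y : ℕ} (huc : u * c = 2 ^ i) (hk : k < 3 * u) (hy : y < c) {su mv ab : Bool} :
    (BFMem.mk l i (2 ^ (i + 4) * l + (k * c + y)) u c su mv ab).expRound = (k % u) * c + y := by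
  have hx : k * c + y < 3 * 2 ^ i := by rw [← huc]; nlinarith
  rw [BFMem.expRound, stageRound_mk hx, ← huc, mul_comm u c, Nat.mod_mul, mul_comm k c,
    Nat.mul_add_mod, Nat.mod_eq_of_lt hy, Nat.mul_add_div (by omega), Nat.div_eq_of_lt hy]
  ring_nf

theorem busy_mk {x : ℕ} (hx : x < 3 * 2 ^ i) {su mv ab : Bool} :
    (BFMem.mk l i (2 ^ (i + 4) * l + x) u c su mv ab).Busy :=
  (BFMem.busy_iff _).mpr ⟨x, hx, rfl⟩

/-- The rounds of a step before its last one. -/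
theorem config_step_prefix {t k : ℕ} {v : V} {p : ℕ} {su ab : Bool} (ht : a.wake ≤ t)
    (hl : l < 2 ^ i) (huc : u * c = 2 ^ i) (hk : k < 3 * u)
    (hcfg : (graphRVBF S).config G a t = ⟨v, p, ⟨l, i, 2 ^ (i + 4) * l + k * c, u, c, su, false, ab⟩⟩)
    (y : ℕ) (hy : y < c) : ∃ v' p' mv,
      (graphRVBF S).config G a (t + y) =
        ⟨v', p', ⟨l, i, 2 ^ (i + 4) * l + (k * c + y), u, c, su, mv, ab⟩⟩ ∧
      StepInv S G a v p ((p + S u (k % u)) % G.deg v) ab t (t + y) v' p' mv := by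
  induction y with
  | zero => exact ⟨v, p, false, hcfg, Or.inl ⟨rfl, rfl, rfl, fun _ s h1 h2 => by omega⟩⟩
  | succ y ih =>
    obtain ⟨v', p', mv, hc, hinv⟩ := ih (by omega)
    have hx : k * c + y + 1 < 3 * 2 ^ i := by rw [← huc]; nlinarith
    have hmod : k % u < u := Nat.mod_lt _ (by omega)
    have he := expRound_mk (l := l) (su := su) (mv := mv) (ab := ab) huc hk (y := y) (by omega)
    obtain ⟨v'', p'', ok, h1, h2⟩ := StepInv.round (q := (p + S u (k % u)) % G.deg v) (by omega) hc
      (busy_mk (by omega)) rfl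
      (by rw [he]; dsimp only
          rw [mul_comm, Nat.mul_add_div (by omega), Nat.div_eq_of_lt (by omega), add_zero]) hinv
    refine ⟨v'', p'', mv || ok, ?_, h2⟩
    rw [← add_assoc, h1, BFMem.update, if_pos (busy_mk (by omega))]
    have hne : ¬ ((k % u) * c + y + 1) % c = 0 := by
      rw [mul_comm, add_assoc, Nat.mul_add_mod, Nat.mod_eq_of_lt hy]; omega
    have he' : ∀ mv, (BFMem.mk l i (2 ^ (i + 4) * l + (k * c + y)) u c su mv ab).expRound =
      (k % u) * c + y := fun mv => expRound_mk huc hk (by omega)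
    have hne2 : ¬ ((k % u) * c + y + 1) = 2 ^ i := by
      rw [← huc]; intro h; rw [h] at hne; exact hne (Nat.mul_mod_left u c)
    have hs : ∀ mv, (BFMem.mk l i (2 ^ (i + 4) * l + (k * c + y)) u c su mv ab).stageRound =
      k * c + y := fun mv => stageRound_mk (by omega)
    have hb := busyPart_le hl hx.le
    simp only [BFMem.endStep, BFMem.endExploration, BFMem.endBusy, he', hs, if_neg hne, if_neg hne2,
      if_neg hx.ne]
    rw [BFMem.tick_eq (by dsimp only; omega)]
    rfl

/-- A whole step. In the last step of the busy part the estimates `u` and `c` are updated. -/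
theorem config_step {t k : ℕ} {v : V} {p : ℕ} {su ab : Bool} (ht : a.wake ≤ t)
    (hl : l < 2 ^ i) (huc : u * c = 2 ^ i) (hk : k < 3 * u)
    (hcfg : (graphRVBF S).config G a t =
      ⟨v, p, ⟨l, i, 2 ^ (i + 4) * l + k * c, u, c, su, false, ab⟩⟩) : ∃ v' p' mv,
      (graphRVBF S).config G a (t + c) = ⟨v', p',
        if k + 1 < 3 * u then ⟨l, i, 2 ^ (i + 4) * l + (k + 1) * c, u, c, su && mv, false,
            if k % u + 1 = u then false else ab || !mv⟩
        else if su && mv then ⟨l, i, 2 ^ (i + 4) * l + (k + 1) * c, 2 * u, c, true, false, false⟩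
        else ⟨l, i, 2 ^ (i + 4) * l + (k + 1) * c, u, 2 * c, true, false, false⟩⟩ ∧
      StepInv S G a v p ((p + S u (k % u)) % G.deg v) ab t (t + c) v' p' mv := by
  have hc0 : 0 < c := Nat.pos_of_mul_pos_left (by rw [huc]; positivity)
  have hu0 : 0 < u := Nat.pos_of_mul_pos_right (by rw [huc]; positivity)
  obtain ⟨y, rfl⟩ : ∃ y, c = y + 1 := ⟨c - 1, by omega⟩
  generalize hc : y + 1 = c at *
  obtain ⟨v', p', mv, hcf, hinv⟩ := config_step_prefix ht hl huc hk hcfg y (by omega)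
  have hx : k * c + y + 1 ≤ 3 * 2 ^ i := by rw [← huc]; nlinarith
  have hmod : k % u < u := Nat.mod_lt _ (by omega)
  have he : ∀ su mv ab, (BFMem.mk l i (2 ^ (i + 4) * l + (k * c + y)) u c su mv ab).expRound =
    (k % u) * c + y := fun su mv ab => expRound_mk huc hk (by omega)
  obtain ⟨v'', p'', ok, h1, h2⟩ := StepInv.round (q := (p + S u (k % u)) % G.deg v) (by omega) hcf
    (busy_mk (by omega)) rfl
    (by rw [he]; dsimp only
        rw [mul_comm, Nat.mul_add_div (by omega), Nat.div_eq_of_lt (by omega), add_zero]) hinv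
  have htc : t + y + 1 = t + c := by omega
  rw [htc] at h1 h2
  refine ⟨v'', p'', mv || ok, ?_, h2⟩
  rw [h1, BFMem.update, if_pos (busy_mk (by omega))]
  have hsum : (k % u) * c + y + 1 = (k % u + 1) * c := by rw [← hc]; ring
  have hs : ∀ su mv ab, (BFMem.mk l i (2 ^ (i + 4) * l + (k * c + y)) u c su mv ab).stageRound =
    k * c + y := fun su mv ab => stageRound_mk (by omega)
  have hsum' : k * c + y + 1 = (k + 1) * c := by rw [← hc]; ring
  have hb := busyPart_le hl hx
  have hend : (k + 1) * c = 3 * 2 ^ i ↔ ¬ k + 1 < 3 * u := by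
    rw [← huc, ← mul_assoc, Nat.mul_left_inj hc0.ne']
    omega
  have hexp : (k % u + 1) * c = 2 ^ i ↔ k % u + 1 = u := by
    rw [← huc, Nat.mul_left_inj hc0.ne']
  have hlast : ¬ k + 1 < 3 * u → k % u + 1 = u := by
    intro h
    have : k = u * 2 + (u - 1) := by omega
    rw [this, Nat.mul_add_mod, Nat.mod_eq_of_lt (by omega)]
    omega
  have hround : 2 ^ (i + 4) * l + (k * c + y) + 1 = 2 ^ (i + 4) * l + (k + 1) * c := by omega
  have hround' : 2 ^ (i + 4) * l + (k * c + y) + 1 < 2 ^ (2 * i + 4) := by omega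
  dsimp only
  generalize (mv || ok) = mv'
  have h3 : (BFMem.mk l i (2 ^ (i + 4) * l + (k * c + y)) u c su mv' ab).endStep =
      ⟨l, i, 2 ^ (i + 4) * l + (k * c + y), u, c, su && mv', false, ab || !mv'⟩ := by
    rw [BFMem.endStep, if_pos]
    rw [he, hsum]
    exact Nat.mul_mod_left _ _
  have h4 : ∀ su ab, (BFMem.mk l i (2 ^ (i + 4) * l + (k * c + y)) u c su false ab).endExploration =
      ⟨l, i, 2 ^ (i + 4) * l + (k * c + y), u, c, su, false, if k % u + 1 = u then false else ab⟩ := by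
    intro su ab
    rw [BFMem.endExploration, he, hsum]
    by_cases h : k % u + 1 = u
    · rw [if_pos (hexp.mpr h), if_pos h]
    · rw [if_neg (fun h' => h (hexp.mp h')), if_neg h]
  rw [h3, h4]
  by_cases hk1 : k + 1 < 3 * u
  · rw [if_pos hk1, BFMem.endBusy, hs, hsum', if_neg (fun h => hend.mp h hk1),
      BFMem.tick_eq hround', hround]
  · rw [if_neg hk1, if_pos (hlast hk1), BFMem.endBusy, hs, hsum', if_pos (hend.mpr hk1)]
    cases su && mv'
    · rw [if_neg Bool.false_ne_true, if_neg Bool.false_ne_true, BFMem.tick_eq hround', hround]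
    · rw [if_pos rfl, if_pos rfl, BFMem.tick_eq hround', hround]

end graphRVBF

/-! ### Successful and unsuccessful phases -/

namespace graphRVBF

variable {V : Type} {S : ℕ → ℕ → ℕ} {G : PortGraph V} {a : AgentSetup V} {l i u c : ℕ}

/-- The steps of a busy part that starts in round `t`. If `c` exceeds the fault bound `cF`, then all
steps succeed. As long as all steps succeed, the first exploration follows the walk prescribed by
the exploration sequence. -/
theorem config_steps {t cF : ℕ} {v : V} {p : ℕ} (ht : a.wake ≤ t)
    (hF : (graphRVBF S).FaultBound G a cF) (hl : l < 2 ^ i) (huc : u * c = 2 ^ i)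
    (hcfg : (graphRVBF S).config G a t = ⟨v, p, ⟨l, i, 2 ^ (i + 4) * l, u, c, true, false, false⟩⟩)
    (k : ℕ) (hk : k < 3 * u) : ∃ v' p' su ab,
      (graphRVBF S).config G a (t + k * c) =
        ⟨v', p', ⟨l, i, 2 ^ (i + 4) * l + k * c, u, c, su, false, ab⟩⟩ ∧
      (su = true → ab = false) ∧ (cF < c → su = true) ∧
      (su = true → k ≤ u → (v', p') = G.uxsWalk (S u) (v, p) k) ∧
      (su = true → ∀ k' ≤ k, k' ≤ u →
        ((graphRVBF S).config G a (t + k' * c)).node = (G.uxsWalk (S u) (v, p) k').1) := by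
  induction k with
  | zero =>
    refine ⟨v, p, true, false, by simpa using hcfg, fun _ => rfl, fun _ => rfl, fun _ _ => rfl, ?_⟩
    intro _ k' hk' _
    obtain rfl : k' = 0 := by omega
    simp [hcfg, PortGraph.uxsWalk]
  | succ k ih =>
    obtain ⟨v', p', su, ab, h1, h2, h3, h4, h5⟩ := ih (by omega)
    obtain ⟨v'', p'', mv, g1, g2⟩ := config_step (by omega) hl huc (by omega) h1
    rw [if_pos hk, add_assoc, ← Nat.succ_mul] at g1
    have hwalk : (su && mv) = true → k + 1 ≤ u → (v'', p'') = G.uxsWalk (S u) (v, p) (k + 1) := by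
      intro hs hku
      rw [Bool.and_eq_true] at hs
      rcases g2 with ⟨hmv, _⟩ | ⟨_, _, hcr⟩
      · rw [hmv] at hs; exact absurd hs.2 (by simp)
      · rw [hcr, PortGraph.uxsWalk, ← h4 hs.1 (by omega),
          Nat.mod_eq_of_lt (show k < u by omega)]
    refine ⟨v'', p'', su && mv, _, g1, ?_, ?_, hwalk, ?_⟩
    · intro hs
      rw [Bool.and_eq_true] at hs
      split_ifs
      · rfl
      · simp [h2 hs.1, hs.2]
    · intro hc
      rcases g2 with ⟨_, _, _, hf⟩ | ⟨hmv, _, _⟩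
      · exact absurd (fun s hs1 hs2 => hf (h2 (h3 hc)) s hs1 (by omega)) (hF (t + k * c))
      · simp [h3 hc, hmv]
    · intro hs k' hk' hku
      rcases Nat.lt_succ_iff_lt_or_eq.mp (Nat.lt_succ_of_le hk') with hlt | rfl
      · rw [Bool.and_eq_true] at hs
        exact h5 hs.1 k' (by omega) hku
      · rw [← hwalk hs hku, g1]

/-- In phase `i` the agent explores the graph with the estimate `u = 2 ^ k`: during the first
exploration of its busy part it follows the walk prescribed by the exploration sequence. -/
def Explores (S : ℕ → ℕ → ℕ) (G : PortGraph V) (a : AgentSetup V) (i k : ℕ) : Prop :=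
  a.label < 2 ^ i ∧
  ((graphRVBF S).config G a (a.wake + phaseStart i)).mem.u = 2 ^ k ∧
  ∃ v p c, p < G.deg v ∧ 2 ^ k * c = 2 ^ i ∧ ∀ k' ≤ 2 ^ k,
    ((graphRVBF S).config G a (a.wake + busyStart a.label i + k' * c)).node =
      (G.uxsWalk (S (2 ^ k)) (v, p) k').1

/-- A phase with a busy part: either the graph is explored and `u` is doubled, or the estimate `c`
does not exceed the fault bound and is doubled. -/
theorem config_phase {k cF : ℕ} {v : V} {p : ℕ} (hF : (graphRVBF S).FaultBound G a cF)
    (hG : ∀ v, 0 < G.deg v) (hl : a.label < 2 ^ i) (huc : 2 ^ k * c = 2 ^ i)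
    (hcfg : (graphRVBF S).config G a (a.wake + phaseStart i) =
      ⟨v, p, ⟨a.label, i, 0, 2 ^ k, c, true, false, false⟩⟩) : ∃ v' p',
    ((graphRVBF S).config G a (a.wake + phaseStart (i + 1)) =
      ⟨v', p', ⟨a.label, i + 1, 0, 2 ^ (k + 1), c, true, false, false⟩⟩ ∧ Explores S G a i k) ∨
    ((graphRVBF S).config G a (a.wake + phaseStart (i + 1)) =
      ⟨v', p', ⟨a.label, i + 1, 0, 2 ^ k, 2 * c, true, false, false⟩⟩ ∧ c ≤ cF) := by
  have hfit := busyPart_le hl le_rfl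
  have hidle : ∀ {x u c su mv ab}, x < 2 ^ (i + 4) * a.label →
      ¬ BFMem.Busy ⟨a.label, i, x, u, c, su, mv, ab⟩ := by
    intro x u c su mv ab hx hb
    obtain ⟨y, _, hy⟩ := (BFMem.busy_iff _).mp hb
    simp only at hy
    omega
  have hidle' : ∀ {x u c su mv ab}, 2 ^ (i + 4) * a.label + 3 * 2 ^ i ≤ x →
      ¬ BFMem.Busy ⟨a.label, i, x, u, c, su, mv, ab⟩ := by
    intro x u c su mv ab hx hb
    obtain ⟨y, hy', hy⟩ := (BFMem.busy_iff _).mp hb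
    simp only at hy hy'
    omega
  have h0 := config_idle (by omega) hcfg (2 ^ (i + 4) * a.label) (by omega)
    (fun x _ hx => hidle (by omega))
  rw [zero_add, add_assoc, ← busyStart] at h0
  have hu : 0 < 2 ^ k := by positivity
  obtain ⟨v₁, p₁, su, ab, h1, h2, h3, h4, h5⟩ :=
    config_steps (by omega) hF hl huc h0 (3 * 2 ^ k - 1) (by omega)
  obtain ⟨v₂, p₂, mv, g1, g2⟩ := config_step (by omega) hl huc (by omega) h1
  have hlast : 3 * 2 ^ k - 1 + 1 = 3 * 2 ^ k := by omega
  rw [hlast, if_neg (lt_irrefl _), add_assoc, ← Nat.succ_mul, Nat.succ_eq_add_one, hlast, mul_assoc,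
    huc] at g1
  -- the rest of the phase is idle
  obtain ⟨d, hd⟩ : ∃ d, 2 ^ (i + 4) * a.label + 3 * 2 ^ i + (d + 1) = 2 ^ (2 * i + 4) :=
    ⟨2 ^ (2 * i + 4) - (2 ^ (i + 4) * a.label + 3 * 2 ^ i) - 1, by omega⟩
  have hnext : a.wake + busyStart a.label i + 3 * 2 ^ i + (d + 1) =
      a.wake + phaseStart (i + 1) := by
    rw [busyStart, phaseStart]; omega
  refine ⟨v₂, p₂, ?_⟩
  cases hs : su && mv with
  | true =>
    rw [hs, if_pos rfl] at g1
    left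
    refine ⟨?_, hl, by rw [hcfg], v, p, c, ?_, huc, fun k' hk' => ?_⟩
    · rw [← hnext, config_idle_to_next (by omega) g1 d hd (fun x hx _ => hidle' hx), pow_succ']
    · have := (graphRVBF S).entry_lt G a hG (a.wake + phaseStart i)
      rwa [hcfg] at this
    · rw [Bool.and_eq_true] at hs
      exact h5 hs.1 k' (by omega) hk'
  | false =>
    rw [hs, if_neg Bool.false_ne_true] at g1
    right
    refine ⟨?_, ?_⟩
    · rw [← hnext, config_idle_to_next (by omega) g1 d hd (fun x hx _ => hidle' hx)]
    · by_contra! hc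
      rcases g2 with ⟨_, _, _, hf⟩ | ⟨hmv, _, _⟩
      · exact hF _ (fun s hs1 hs2 => hf (h2 (h3 hc)) s hs1 (by omega))
      · rw [h3 hc, hmv] at hs; simp at hs

/-- Phases that are too short to have a busy part. -/
theorem config_early_phase {i : ℕ} (hi : i ≤ Nat.clog 2 (a.label + 1)) :
    (graphRVBF S).config G a (a.wake + phaseStart i) =
      ⟨a.start, 0, ⟨a.label, i, 0, 1, 2 ^ Nat.clog 2 (a.label + 1), true, false, false⟩⟩ := by
  induction i with
  | zero =>
    rw [AgentAlgorithm.config_of_le_wake _ _ (by simp [phaseStart])]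
    rfl
  | succ i ih =>
    have hpow : 2 ^ i < a.label + 1 := (Nat.lt_clog_iff_pow_lt one_lt_two).mp hi
    have h4 : 2 ^ (2 * i + 4) = 2 ^ (i + 4) * 2 ^ i := by ring
    obtain ⟨d, hd⟩ : ∃ d, 0 + (d + 1) = 2 ^ (2 * i + 4) :=
      ⟨2 ^ (2 * i + 4) - 1, by have : 0 < 2 ^ (2 * i + 4) := by positivity
                               omega⟩
    have hnext : a.wake + phaseStart (i + 1) = a.wake + phaseStart i + (d + 1) := by
      rw [phaseStart]; omega
    rw [hnext]
    refine config_idle_to_next (by omega) (ih (by omega)) d hd fun x _ hx hb => ?_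
    obtain ⟨y, _, hy⟩ := (BFMem.busy_iff _).mp hb
    have := Nat.mul_le_mul_left (2 ^ (i + 4)) (Nat.lt_succ_iff.mp hpow)
    simp only at hy
    omega

/-- The estimates at the beginning of phase `i`: `u = 2 ^ s` where `s` is the number of phases so far
in which the graph was explored, and `c` is at most `2 * cF` times its initial value. -/
theorem exists_estimates {cF : ℕ} (hcF : 0 < cF) (hF : (graphRVBF S).FaultBound G a cF)
    (hG : ∀ v, 0 < G.deg v) {i : ℕ} (hi : Nat.clog 2 (a.label + 1) ≤ i) : ∃ v p s c,
    (graphRVBF S).config G a (a.wake + phaseStart i) =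
      ⟨v, p, ⟨a.label, i, 0, 2 ^ s, c, true, false, false⟩⟩ ∧
    2 ^ s * c = 2 ^ i ∧ c ≤ 2 ^ Nat.clog 2 (a.label + 1) * (2 * cF) ∧
    ∀ k < s, ∃ i' < i, Explores S G a i' k := by
  induction i, hi using Nat.le_induction with
  | base =>
    refine ⟨_, _, 0, _, config_early_phase le_rfl, by simp, Nat.le_mul_of_pos_right _ (by omega), ?_⟩
    intro k hk
    omega
  | succ i hi ih =>
    obtain ⟨v, p, s, c, h1, h2, h3, h4⟩ := ih
    have hl : a.label < 2 ^ i := (Nat.clog_le_iff_le_pow one_lt_two).mp hi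
    obtain ⟨v', p', h | h⟩ := config_phase hF hG hl h2 h1
    · refine ⟨v', p', s + 1, c, h.1, by rw [pow_succ, pow_succ, ← h2]; ring, h3, fun k hk => ?_⟩
      rcases Nat.lt_succ_iff_lt_or_eq.mp hk with hk | rfl
      · obtain ⟨i', hi', he⟩ := h4 k hk
        exact ⟨i', by omega, he⟩
      · exact ⟨i, by omega, h.2⟩
    · refine ⟨v', p', s, 2 * c, h.1, by rw [pow_succ, ← h2]; ring, ?_, fun k hk => ?_⟩
      · calc 2 * c ≤ 1 * (2 * cF) := by omega
          _ ≤ _ := Nat.mul_le_mul_right _ (Nat.one_le_two_pow)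
      · obtain ⟨i', hi', he⟩ := h4 k hk
        exact ⟨i', by omega, he⟩

end graphRVBF

/-! ### Simultaneous busy parts -/

/-- The busy part of phase `i` of an agent with label `l` and the busy part of phase `j` of an agent
with label `l'` that is woken up `δ` rounds later have a common round. -/
def Clash (δ l l' i j : ℕ) : Prop :=
  ∃ x < 3 * 2 ^ i, ∃ y < 3 * 2 ^ j, busyStart l i + x = δ + busyStart l' j + y

theorem Clash.le {δ l l' i j : ℕ} (h : Clash δ l l' i j) (hl : l < 2 ^ i) : j ≤ i := by
  obtain ⟨x, hx, y, _, h⟩ := h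
  by_contra! hij
  have h1 := busyPart_le hl hx.le
  have h2 : phaseStart (i + 1) ≤ phaseStart j := phaseStart_mono hij
  rw [phaseStart] at h2
  simp only [busyStart] at h
  omega

/-- Two clashes with `i - j` in the same one of the classes `0`, `1`, `≥ 2` happen in the same phase
`i` of the earlier agent. -/
theorem Clash.not_lt {δ l l' i j i' j' : ℕ} (h : Clash δ l l' i j) (h' : Clash δ l l' i' j')
    (hne : l ≠ l') (hl : l < 2 ^ i) (hj : l' < 2 ^ j) (hl' : l < 2 ^ i') (hj' : l' < 2 ^ j')
    (hclass : min (i - j) 2 = min (i' - j') 2) : ¬ i < i' := by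
  intro hlt
  have hji := h.le hl
  have hji' := h'.le hl'
  obtain ⟨x, hx, y, hy, h⟩ := h
  obtain ⟨x', hx', y', hy', h'⟩ := h'
  have ei := three_mul_phaseStart i
  have ej := three_mul_phaseStart j
  have ei' := three_mul_phaseStart i'
  have ej' := three_mul_phaseStart j'
  have hE : 2 * 2 ^ i ≤ 2 ^ i' := by rw [← pow_succ']; exact Nat.pow_le_pow_right (by omega) hlt
  have hE0 : 0 < 2 ^ i := by positivity
  have h16 : ∀ m, 2 ^ (m + 4) = 2 ^ m * 16 := fun m => by ring
  simp only [busyStart, h16] at h h'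
  generalize phaseStart i = a at *
  generalize phaseStart i' = a' at *
  generalize phaseStart j = b at *
  generalize phaseStart j' = b' at *
  have hcases : (j = i ∧ j' = i') ∨ (i = j + 1 ∧ i' = j' + 1) ∨ (j' + 2 ≤ i') := by omega
  rcases hcases with ⟨rfl, rfl⟩ | ⟨rfl, rfl⟩ | h2
  -- the overlaps determine `δ` up to `3 * 2 ^ i`, but `16 * 2 ^ i * (l - l')` at least doubles
  · generalize 2 ^ j = E at *
    generalize 2 ^ j' = E' at *
    obtain rfl : a = b := by omega
    obtain rfl : a' = b' := by omega
    zify at *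
    have key : 16 * (E' - E) * (l - l' : ℤ) = (x - y) - (x' - y') := by linarith
    rcases lt_or_gt_of_ne hne with hlt | hlt
    · have h1 : 16 * (E' - E) * (l - l' : ℤ) ≤ 16 * (E' - E) * (-1) := by
        gcongr <;> linarith
      linarith
    · have h1 : 16 * (E' - E) * 1 ≤ 16 * (E' - E) * (l - l' : ℤ) := by
        gcongr <;> linarith
      linarith
  -- with `F = 2 ^ j` the overlaps determine `16 * F * (F + 2 * l - l')`, which grows since `l' < F`
  · rw [pow_succ] at *
    rw [pow_succ] at *
    generalize 2 ^ j = F at *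
    generalize 2 ^ j' = F' at *
    zify at *
    have key : 16 * (F' - F) * (F' + F + 2 * l - l' : ℤ) = (x - y) - (x' - y') := by linarith
    have h1 : (F' : ℤ) ≤ F' + F + 2 * l - l' := by linarith
    have h3 : 0 ≤ (16 * (F' - F) : ℤ) := by linarith
    have h4 := mul_le_mul_of_nonneg_left h1 h3
    rw [key] at h4
    have h5 : (F' * F' : ℤ) ≤ 2 * (F' - F) * F' := by gcongr; linarith
    have h6 : (2 * F' : ℤ) ≤ F' * F' := by gcongr; linarith
    linarith
  -- the phases of the later agent up to `j'` fill too small a part of the time between the phases `i`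
  -- and `i'` of the earlier one
  · have h4 : 4 * 2 ^ j' ≤ 2 ^ i' := by
      calc 4 * 2 ^ j' = 2 ^ (j' + 2) := by ring
        _ ≤ _ := Nat.pow_le_pow_right (by omega) h2
    generalize 2 ^ i = E at *
    generalize 2 ^ i' = E' at *
    generalize 2 ^ j = F at *
    generalize 2 ^ j' = F' at *
    zify at *
    have k1 : (E * 16 * l : ℤ) ≤ E' * 16 * l := by gcongr; linarith
    have k2 : (F' * l' : ℤ) ≤ F' * (F' - 1) := by gcongr; linarith
    have k3 : (0 : ℤ) ≤ F * l' := by positivity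
    have k4 : (4 * F' * (4 * F') : ℤ) ≤ E' * E' := by gcongr
    have k5 : (2 * E * (2 * E) : ℤ) ≤ E' * E' := by gcongr
    have k6 : (E' * 2 : ℤ) ≤ E' * E' := by gcongr; linarith
    have k7 : (F' : ℤ) ≥ 0 := by positivity
    have k8 : (b : ℤ) ≥ 0 := by positivity
    linarith

/-! ### Rendezvous -/

/-- Every node of a connected graph with two different nodes has a port. -/
theorem PortGraph.deg_pos {V : Type} (G : PortGraph V) (hG : G.graph.Connected) [Nontrivial V]
    (v : V) : 0 < G.deg v := by
  obtain ⟨w, hw⟩ := hG.preconnected.exists_adj_of_nontrivial v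
  exact Fin.pos ((G.port v).symm ⟨w, hw⟩)

theorem two_pow_clog_lt {x : ℕ} (hx : 0 < x) : 2 ^ Nat.clog 2 x < 2 * x := by
  rcases Nat.lt_or_ge 1 x with h | h
  · obtain ⟨m, hm⟩ : ∃ m, Nat.clog 2 x = m + 1 :=
      Nat.exists_eq_succ_of_ne_zero (Nat.clog_pos one_lt_two h).ne'
    have := Nat.pow_pred_clog_lt_self one_lt_two h
    rw [hm] at this ⊢
    rw [pow_succ']
    exact Nat.mul_lt_mul_of_pos_left this two_pos
  · rw [Nat.clog_of_right_le_one h]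
    omega

namespace graphRVBF

variable {V : Type} {S : ℕ → ℕ → ℕ} {G : PortGraph V} {a b : AgentSetup V}

/-- An agent that explores the whole graph meets the other agent, or the other agent is busy at the
same time. -/
theorem Explores.meet_or_clash [Fintype V] [Nontrivial V] {n i k : ℕ} (hG : G.graph.Connected)
    (hn : Fintype.card V ≤ n) (hS : IsUXS (S (2 ^ k)) (2 ^ k) n) (hab : a.wake ≤ b.wake)
    (h : Explores S G a i k) :
    (∃ t, a.wake ≤ t ∧ t ≤ a.wake + phaseStart (i + 1) ∧
      ((graphRVBF S).config G a t).node = ((graphRVBF S).config G b t).node) ∨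
    ∃ j, b.label < 2 ^ j ∧ Clash (b.wake - a.wake) a.label b.label i j := by
  obtain ⟨hl, _, v, p, c, hp, hkc, hwalk⟩ := h
  have hend : ∀ x ≤ 2 ^ i, a.wake + busyStart a.label i + x ≤ a.wake + phaseStart (i + 1) := by
    intro x hx
    have := busyPart_le hl (show x ≤ 3 * 2 ^ i by omega)
    rw [phaseStart, busyStart]
    omega
  by_cases hidle : ∀ x < 2 ^ i,
      ((graphRVBF S).config G b (a.wake + busyStart a.label i + (x + 1))).node =
        ((graphRVBF S).config G b (a.wake + busyStart a.label i + x)).node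
  · left
    have hconst : ∀ x ≤ 2 ^ i, ((graphRVBF S).config G b (a.wake + busyStart a.label i + x)).node =
        ((graphRVBF S).config G b (a.wake + busyStart a.label i)).node := by
      intro x hx
      induction x with
      | zero => rfl
      | succ x ih => rw [hidle x (by omega), ih (by omega)]
    generalize hz : ((graphRVBF S).config G b (a.wake + busyStart a.label i)).node = z at hconst
    obtain ⟨y, hy⟩ := hG.preconnected.exists_adj_of_nontrivial z
    obtain ⟨k', hk', hvisit⟩ : ∃ k' ≤ 2 ^ k, (G.uxsWalk (S (2 ^ k)) (v, p) k').1 = z := by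
      obtain ⟨k', hk', ⟨h, _⟩ | ⟨_, h⟩⟩ := hS V G hG hn v p hp z y hy
      · exact ⟨k', hk'.le, h⟩
      · exact ⟨k' + 1, hk', h⟩
    have hx : k' * c ≤ 2 ^ i := by rw [← hkc]; exact Nat.mul_le_mul_right _ hk'
    exact ⟨a.wake + busyStart a.label i + k' * c, by omega, hend _ hx, by
      rw [hwalk k' hk', hconst _ hx, hvisit]⟩
  · right
    push Not at hidle
    obtain ⟨x, hx, hne⟩ := hidle
    obtain ⟨j, hj, y, hy, ht⟩ := exists_busy_of_node_ne hne
    refine ⟨j, hj, x, by omega, y, hy, ?_⟩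
    change a.wake + busyStart a.label i + x = _ at ht
    omega

/-- If the length `2 ^ p` suffices and if the agent woken up first explores the graph with each of
`u = 2 ^ p, …, 2 ^ (p + 3)` before its phase `I`, then the agents have met when phase `I` begins: by the
pigeonhole principle for the three classes of `Clash.not_lt`, one of the four explorations is not
disturbed by the other agent. -/
theorem exists_meeting [Fintype V] [Nontrivial V] {n p s I : ℕ} (hG : G.graph.Connected)
    (hn : Fintype.card V ≤ n) (hS : ∀ k, p ≤ k → IsUXS (S (2 ^ k)) (2 ^ k) n)
    (hab : a.wake ≤ b.wake) (hne : a.label ≠ b.label) (hs : p + 4 ≤ s)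
    (h : ∀ k < s, ∃ i < I, Explores S G a i k) :
    ∃ t, a.wake ≤ t ∧ t ≤ a.wake + phaseStart I ∧
      ((graphRVBF S).config G a t).node = ((graphRVBF S).config G b t).node := by
  by_contra! hno
  have hclash : ∀ k : Fin 4, ∃ i j, Explores S G a i (p + k) ∧ b.label < 2 ^ j ∧
      Clash (b.wake - a.wake) a.label b.label i j := by
    intro k
    obtain ⟨i, hi, he⟩ := h (p + k) (by omega)
    rcases he.meet_or_clash hG hn (hS _ (by omega)) hab with ⟨t, h1, h2, h3⟩ | ⟨j, h1, h2⟩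
    · have : phaseStart (i + 1) ≤ phaseStart I := phaseStart_mono hi
      exact absurd h3 (hno t h1 (by omega))
    · exact ⟨i, j, he, h1, h2⟩
  choose i j he hj hc using hclash
  obtain ⟨k, k', hkk, heq⟩ := Fintype.exists_ne_map_eq_of_card_lt
    (fun k => (⟨min (i k - j k) 2, by omega⟩ : Fin 3)) (by simp)
  have heq' : min (i k - j k) 2 = min (i k' - j k') 2 := by simpa using heq
  have h1 := (hc k).not_lt (hc k') hne (he k).1 (hj k) (he k').1 (hj k') heq'
  have h2 := (hc k').not_lt (hc k) hne (he k').1 (hj k') (he k).1 (hj k) heq'.symm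
  -- different estimates `u` belong to different phases
  have h3 := (he k).2.1
  rw [show i k = i k' by omega, (he k').2.1] at h3
  have h4 := Nat.pow_right_injective le_rfl h3
  exact hkk (Fin.ext (by omega))

/-- The time until rendezvous if `a` is not woken up after `b`. -/
theorem exists_meeting_le [Fintype V] {P : ℕ → ℕ} (hS : IsUXSFamily S P) (hG : G.graph.Connected)
    {c : ℕ} (hc : 0 < c) (hstart : a.start ≠ b.start) (ha : 0 < a.label)
    (hne : a.label ≠ b.label) (hF : (graphRVBF S).FaultBound G a c) (hab : a.wake ≤ b.wake) :
    ∃ t ≤ 2 ^ 19 * (P (Fintype.card V) * c * a.label) ^ 2,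
      ((graphRVBF S).config G a (a.wake + t)).node =
        ((graphRVBF S).config G b (a.wake + t)).node := by
  have : Nontrivial V := ⟨_, _, hstart⟩
  have hdeg := G.deg_pos hG
  set N := P (Fintype.card V) with hN
  have hN0 : 0 < N := by
    obtain ⟨y, hy⟩ := hG.preconnected.exists_adj_of_nontrivial a.start
    obtain ⟨k, hk, -⟩ := hS _ _ le_rfl V G hG le_rfl a.start 0 (hdeg _) _ _ hy
    omega
  -- the first phase `I` with `128 * N * c * a.label ≤ 2 ^ I`: the estimate of the fault bound is then
  -- at most `4 * c * a.label`, so that `u ≥ 32 * N`, which leaves room for four values of `u` from `N` on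
  set X := N * c * a.label with hX
  have hX0 : 0 < X := by positivity
  set I := Nat.clog 2 (128 * X) with hI
  have hI1 : 128 * X ≤ 2 ^ I := Nat.le_pow_clog one_lt_two _
  have hI2 : 2 ^ I < 2 * (128 * X) := two_pow_clog_lt (by omega)
  have hq : 2 ^ Nat.clog 2 (a.label + 1) ≤ 2 * a.label := by
    obtain ⟨m, hm⟩ : ∃ m, Nat.clog 2 (a.label + 1) = m + 1 :=
      Nat.exists_eq_succ_of_ne_zero (Nat.clog_pos one_lt_two (by omega)).ne'
    have := two_pow_clog_lt (x := a.label + 1) (by omega)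
    rw [hm, pow_succ] at *
    omega
  have hqI : Nat.clog 2 (a.label + 1) ≤ I := by
    apply Nat.clog_mono_right
    have : a.label ≤ X := Nat.le_mul_of_pos_left _ (by positivity)
    omega
  obtain ⟨v, e, s, c', _, h1, h2, h3⟩ := exists_estimates hc hF hdeg hqI
  set p := Nat.clog 2 N
  have hp1 : N ≤ 2 ^ p := Nat.le_pow_clog one_lt_two _
  have hs : p + 4 ≤ s := by
    have hc' : c' ≤ 4 * c * a.label := h2.trans (by nlinarith)
    have hc0 : 0 < c * a.label := by positivity
    have h32 : 32 * N ≤ 2 ^ s := by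
      by_contra! hlt
      have : 2 ^ s * c' < 32 * N * (4 * c * a.label) := by
        calc 2 ^ s * c' ≤ 2 ^ s * (4 * c * a.label) := Nat.mul_le_mul_left _ hc'
          _ < _ := by
            apply Nat.mul_lt_mul_of_pos_right hlt
            rw [mul_assoc]; omega
      have : 32 * N * (4 * c * a.label) = 128 * X := by rw [hX]; ring
      omega
    rw [← Nat.pow_le_pow_iff_right one_lt_two]
    have hp2 : 2 ^ p < 2 * N := two_pow_clog_lt hN0
    have hp4 : 2 ^ (p + 4) = 16 * 2 ^ p := by ring
    omega
  obtain ⟨t, ht1, ht2, ht3⟩ := exists_meeting hG le_rfl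
    (fun k hk => hS _ _ (hp1.trans (Nat.pow_le_pow_right two_pos hk))) hab hne hs h3
  obtain ⟨t, rfl⟩ := Nat.exists_eq_add_of_le ht1
  refine ⟨t, ?_, ht3⟩
  have := three_mul_phaseStart I
  have hsq := Nat.mul_le_mul hI2.le hI2.le
  nlinarith

/-- Algorithm Graph-RV-BF works in time `O((P(n) c L) ^ 2)`. -/
theorem worksInTime {P : ℕ → ℕ} (hS : IsUXSFamily S P) :
    (graphRVBF S).WorksInTime (fun n c L => 2 ^ 19 * (P n * c * L) ^ 2) := by
  intro V _ G hG c hc a b hstart ha hb hne hFa hFb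
  have key : ∃ t ≤ 2 ^ 19 * (P (Fintype.card V) * c * max a.label b.label) ^ 2,
      ((graphRVBF S).config G a (min a.wake b.wake + t)).node =
        ((graphRVBF S).config G b (min a.wake b.wake + t)).node := by
    rcases le_total a.wake b.wake with hab | hab
    · obtain ⟨t, h1, h2⟩ := exists_meeting_le hS hG hc hstart ha hne hFa hab
      rw [min_eq_left hab]
      refine ⟨t, h1.trans ?_, h2⟩
      gcongr
      exact le_max_left _ _
    · obtain ⟨t, h1, h2⟩ := exists_meeting_le hS hG hc hstart.symm hb hne.symm hFb hab
      rw [min_eq_right hab]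
      refine ⟨t, h1.trans ?_, h2.symm⟩
      gcongr
      exact le_max_right _ _
  obtain ⟨t, h1, h2⟩ := key
  classical
  have hex : ∃ t, ((graphRVBF S).config G a (min a.wake b.wake + t)).node =
    ((graphRVBF S).config G b (min a.wake b.wake + t)).node := ⟨t, h2⟩
  exact ⟨Nat.find hex, ⟨Nat.find_spec hex, fun t' ht' => Nat.find_min' hex ht'⟩,
    (Nat.find_min' hex h2).trans h1⟩

end graphRVBF

/-- A polynomial length function yields a polynomial time bound. -/
theorem exists_polynomial_time {S : ℕ → ℕ → ℕ} {P : Polynomial ℕ}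
    (hS : IsUXSFamily S (fun n => P.eval n)) : ∃ Q : MvPolynomial (Fin 3) ℕ,
      (graphRVBF S).WorksInTime (fun n c L => MvPolynomial.eval ![n, c, L] Q) := by
  refine ⟨MvPolynomial.C (2 ^ 19) * (Polynomial.aeval (MvPolynomial.X 0) P * MvPolynomial.X 1 *
    MvPolynomial.X 2) ^ 2, ?_⟩
  convert graphRVBF.worksInTime hS using 4 with n c L
  have : MvPolynomial.eval ![n, c, L] (Polynomial.aeval (MvPolynomial.X 0) P) = P.eval n := by
    rw [Polynomial.aeval_def, Polynomial.hom_eval₂, Subsingleton.elim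
      ((MvPolynomial.eval ![n, c, L]).comp (algebraMap ℕ (MvPolynomial (Fin 3) ℕ))) (RingHom.id ℕ)]
    simp [Polynomial.eval₂_id]
  simp only [map_mul, map_pow, this, MvPolynomial.eval_C, MvPolynomial.eval_X]
  simp

/-! ### Random walks: the time until a set of darts is traversed -/

/-- The darts that lead to `u`. -/
def entering {V : Type} (u : V) : V → V → Prop := fun _ w => w = u

theorem entering_iff {V : Type} {u v w : V} : entering u v w ↔ w = u := Iff.rfl

section RandomWalk

open Finset

variable {V : Type} [Fintype V] (H : SimpleGraph V) (A : V → V → Prop)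

open Classical in
/-- The set of neighbours of `v`. -/
noncomputable def nbrs (v : V) : Finset V := univ.filter (H.Adj v)

@[simp]
theorem mem_nbrs {v w : V} : w ∈ nbrs H v ↔ H.Adj v w := by simp [nbrs]

open Classical in
/-- The probability that the simple random walk from `v` traverses none of the darts `(x, y)` with
`A x y` in its first `t` steps. -/
noncomputable def survival : ℕ → V → ℚ
  | 0, _ => 1
  | t + 1, v => (∑ w ∈ nbrs H v with ¬ A v w, survival t w) / #(nbrs H v)

/-- The expected number of steps, truncated at `T`, until the simple random walk from `v` traverses
one of the darts `(x, y)` with `A x y`. -/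
noncomputable def hitTime (T : ℕ) (v : V) : ℚ := ∑ t ∈ range T, survival H A t v

theorem survival_nonneg (t : ℕ) (v : V) : 0 ≤ survival H A t v := by
  induction t generalizing v with
  | zero => simp [survival]
  | succ t ih =>
    rw [survival]
    exact div_nonneg (sum_nonneg fun w _ => ih w) (Nat.cast_nonneg _)

theorem survival_succ_le (t : ℕ) (v : V) : survival H A (t + 1) v ≤ survival H A t v := by
  induction t generalizing v with
  | zero =>
    classical
    simp only [survival, sum_const, nsmul_eq_mul, mul_one]
    exact div_le_one_of_le₀ (Nat.cast_le.mpr (card_filter_le _ _)) (Nat.cast_nonneg _)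
  | succ t ih =>
    rw [survival, survival]
    exact div_le_div_of_nonneg_right (sum_le_sum fun w _ => ih w) (Nat.cast_nonneg _)

theorem survival_antitone (v : V) : Antitone fun t => survival H A t v :=
  antitone_nat_of_succ_le fun t => survival_succ_le H A t v

theorem hitTime_nonneg (T : ℕ) (v : V) : 0 ≤ hitTime H A T v :=
  sum_nonneg fun t _ => survival_nonneg H A t v

theorem hitTime_le_succ (T : ℕ) (v : V) : hitTime H A T v ≤ hitTime H A (T + 1) v := by
  rw [hitTime, hitTime, sum_range_succ]
  exact le_add_of_nonneg_right (survival_nonneg H A T v)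

open Classical in
theorem hitTime_succ (T : ℕ) (v : V) :
    hitTime H A (T + 1) v = 1 + (∑ w ∈ nbrs H v with ¬ A v w, hitTime H A T w) / #(nbrs H v) := by
  simp only [hitTime]
  rw [sum_range_succ', sum_comm, sum_div, add_comm]
  simp only [survival]

theorem mul_survival_le_hitTime (T : ℕ) (v : V) : T * survival H A T v ≤ hitTime H A T v := by
  rw [hitTime, ← nsmul_eq_mul]
  have := card_nsmul_le_sum (range T) (fun t => survival H A t v) (survival H A T v)
    fun t ht => survival_antitone H A v (mem_range.mp ht).le
  simpa using this

theorem survival_add_le {T : ℕ} {ε : ℚ} (h : ∀ v, survival H A T v ≤ ε) (t : ℕ) (v : V) :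
    survival H A (T + t) v ≤ ε * survival H A t v := by
  induction t generalizing v with
  | zero => simpa [survival] using h v
  | succ t ih =>
    rw [← add_assoc, survival, survival, ← mul_div_assoc, mul_sum]
    exact div_le_div_of_nonneg_right (sum_le_sum fun w _ => ih w) (Nat.cast_nonneg _)

theorem survival_mul_le {T : ℕ} {ε : ℚ} (hε : 0 ≤ ε) (h : ∀ v, survival H A T v ≤ ε) (r : ℕ) (v : V) :
    survival H A (T * r) v ≤ ε ^ r := by
  induction r with
  | zero => simp [survival]
  | succ r ih =>
    rw [mul_add, mul_one, add_comm, pow_succ']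
    exact (survival_add_le H A h _ v).trans (mul_le_mul_of_nonneg_left ih hε)

theorem sum_nbrs_comm (f : V → ℚ) :
    ∑ v, ∑ w ∈ nbrs H v, f w = ∑ w, #(nbrs H w) * f w := by
  rw [sum_comm' (t' := univ) (s' := fun w => nbrs H w) (by simp [H.adj_comm])]
  simp

variable {H}

open Classical in
/-- The uniform distribution on the darts is stationary, so the expected time between two traversals
of darts in `A`, weighted by their number, is at most the total number of darts. -/
theorem sum_hitTime_le (hH : ∀ v, 0 < #(nbrs H v)) (T : ℕ) :
    ∑ v, ∑ w ∈ nbrs H v with A v w, hitTime H A T w ≤ (Fintype.card V : ℚ) ^ 2 := by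
  have h1 : ∀ v, (#(nbrs H v) : ℚ) * hitTime H A (T + 1) v =
      #(nbrs H v) + ∑ w ∈ nbrs H v with ¬ A v w, hitTime H A T w := by
    intro v
    have : (#(nbrs H v) : ℚ) ≠ 0 := by exact_mod_cast (hH v).ne'
    rw [hitTime_succ]
    field_simp
  have h2 : ∑ v, (#(nbrs H v) : ℚ) * hitTime H A T v ≤
      ∑ v, (#(nbrs H v) : ℚ) * hitTime H A (T + 1) v :=
    sum_le_sum fun v _ => mul_le_mul_of_nonneg_left (hitTime_le_succ H A T v) (Nat.cast_nonneg _)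
  rw [sum_congr rfl fun v _ => h1 v, sum_add_distrib, ← sum_nbrs_comm] at h2
  have h3 : ∑ v, ∑ w ∈ nbrs H v, hitTime H A T w =
      ∑ v, ∑ w ∈ nbrs H v with A v w, hitTime H A T w +
        ∑ v, ∑ w ∈ nbrs H v with ¬ A v w, hitTime H A T w := by
    rw [← sum_add_distrib]
    exact sum_congr rfl fun v _ => (sum_filter_add_sum_filter_not _ _ _).symm
  have h4 : ∑ v, (#(nbrs H v) : ℚ) ≤ (Fintype.card V : ℚ) ^ 2 := by
    calc ∑ v, (#(nbrs H v) : ℚ) ≤ ∑ _v : V, (Fintype.card V : ℚ) :=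
          sum_le_sum fun v _ => by exact_mod_cast card_le_univ _
      _ = _ := by simp [sq]
  linarith

/-- The expected time to return to a traversal of a dart. -/
theorem hitTime_head_le (hH : ∀ v, 0 < #(nbrs H v)) (T : ℕ) {y z : V} (hyz : H.Adj y z)
    (hA : A y z) : hitTime H A T z ≤ (Fintype.card V : ℚ) ^ 2 := by
  classical
  refine le_trans ?_ (sum_hitTime_le A hH T)
  calc hitTime H A T z ≤ ∑ w ∈ nbrs H y with A y w, hitTime H A T w :=
        single_le_sum (f := hitTime H A T) (fun w _ => hitTime_nonneg H A T w) (by simp [hyz, hA])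
    _ ≤ _ := single_le_sum (f := fun v => ∑ w ∈ nbrs H v with A v w, hitTime H A T w)
        (fun v _ => sum_nonneg fun w _ => hitTime_nonneg H A T w) (mem_univ y)

/-- The expected time to reach a neighbour. -/
theorem hitTime_entering_le_of_adj (hH : ∀ v, 0 < #(nbrs H v)) (T : ℕ) {u v : V} (h : H.Adj u v) :
    hitTime H (entering u) T v ≤ (Fintype.card V : ℚ) ^ 2 := by
  classical
  have h0 : (#(nbrs H u) : ℚ) ≠ 0 := by exact_mod_cast (hH u).ne'
  have h1 : hitTime H (entering u) T v ≤
      ∑ w ∈ nbrs H u with ¬ entering u u w, hitTime H (entering u) T w :=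
    single_le_sum (f := hitTime H (entering u) T) (fun w _ => hitTime_nonneg H _ T w)
      (by simp [h, entering_iff, h.ne'])
  have h2 : (#(nbrs H u) : ℚ) * hitTime H (entering u) (T + 1) u =
      #(nbrs H u) + ∑ w ∈ nbrs H u with ¬ entering u u w, hitTime H (entering u) T w := by
    rw [hitTime_succ]
    field_simp
  -- the darts leading to `u` all have the same head
  have h3 : ∑ v, ∑ w ∈ nbrs H v with entering u v w, hitTime H (entering u) (T + 1) w =
      #(nbrs H u) * hitTime H (entering u) (T + 1) u := by
    have : ∀ v, (nbrs H v).filter (entering u v) = if v ∈ nbrs H u then {u} else ∅ := by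
      intro v
      ext w
      by_cases hw : w = u
      · subst hw
        by_cases hv : H.Adj w v <;> simp [entering_iff, hv, H.adj_comm v w]
      · by_cases hv : H.Adj u v <;> simp [entering_iff, hv, hw]
    simp only [this, apply_ite (fun s => ∑ w ∈ s, hitTime H (entering u) (T + 1) w),
      sum_singleton, sum_empty]
    rw [← sum_filter, sum_const, nsmul_eq_mul, filter_univ_mem]
  have h4 := sum_hitTime_le (entering u) hH (T + 1)
  have h5 : (0 : ℚ) ≤ #(nbrs H u) := Nat.cast_nonneg _
  linarith

/-- To traverse a dart in `A` one may first go to `u`. -/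
theorem hitTime_le_add (hH : ∀ v, 0 < #(nbrs H v)) (T : ℕ) (u v : V) :
    hitTime H A T v ≤ hitTime H (entering u) T v + hitTime H A T u := by
  classical
  induction T generalizing v with
  | zero => simp [hitTime]
  | succ T ih =>
    have h0 : (#(nbrs H v) : ℚ) ≠ 0 := by exact_mod_cast (hH v).ne'
    have h1 : ∑ w ∈ nbrs H v with ¬ A v w, hitTime H A T w ≤
        ∑ w ∈ nbrs H v with ¬ entering u v w, hitTime H (entering u) T w +
          #(nbrs H v) * hitTime H A T u := by
      calc ∑ w ∈ nbrs H v with ¬ A v w, hitTime H A T w ≤ ∑ w ∈ nbrs H v, hitTime H A T w :=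
            sum_le_sum_of_subset_of_nonneg (filter_subset _ _)
              fun w _ _ => hitTime_nonneg H A T w
        _ ≤ ∑ w ∈ nbrs H v, ((if ¬ entering u v w then hitTime H (entering u) T w else 0) +
              hitTime H A T u) := by
            refine sum_le_sum fun w _ => ?_
            by_cases hw : w = u
            · simp [entering_iff, hw]
            · simpa [entering_iff, hw] using ih w
        _ = _ := by rw [sum_add_distrib, ← sum_filter, sum_const, nsmul_eq_mul]
    calc hitTime H A (T + 1) v
        ≤ 1 + (∑ w ∈ nbrs H v with ¬ entering u v w, hitTime H (entering u) T w +
          #(nbrs H v) * hitTime H A T u) / #(nbrs H v) := by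
          rw [hitTime_succ]; gcongr
      _ = hitTime H (entering u) (T + 1) v + hitTime H A T u := by
          rw [hitTime_succ]; field_simp; ring
      _ ≤ _ := by gcongr; exact hitTime_le_succ H A T u

theorem hitTime_entering_le_of_walk (hH : ∀ v, 0 < #(nbrs H v)) (T : ℕ) {u v : V} (p : H.Walk v u) :
    hitTime H (entering u) T v ≤ (p.length + 1) * (Fintype.card V : ℚ) ^ 2 := by
  induction p with
  | nil =>
    rename_i u
    obtain ⟨w, hw⟩ := card_pos.mp (hH u)
    simpa using hitTime_head_le (entering u) hH T ((mem_nbrs H).mp hw).symm rfl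
  | cons h p ih =>
    rename_i v w u
    have h1 := hitTime_le_add (entering u) hH T w v
    have h2 := hitTime_entering_le_of_adj hH T h.symm
    rw [SimpleGraph.Walk.length_cons]
    push_cast
    linarith

/-- The expected time until a given dart is traversed is `O(n ^ 3)`. -/
theorem hitTime_le (hH : ∀ v, 0 < #(nbrs H v)) (hc : H.Connected) (T : ℕ) (v : V) {y z : V}
    (hyz : H.Adj y z) (hA : A y z) : hitTime H A T v ≤ 2 * (Fintype.card V : ℚ) ^ 3 := by
  classical
  obtain ⟨p⟩ := hc.preconnected v z
  have h1 := hitTime_le_add A hH T z v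
  have h2 := hitTime_entering_le_of_walk hH T p.bypass
  have h3 := hitTime_head_le A hH T hyz hA
  have h4 : ((p.bypass.length : ℚ) + 1) ≤ Fintype.card V := by
    exact_mod_cast (p.bypass_isPath).length_lt
  have h5 : (1 : ℚ) ≤ Fintype.card V := by
    have := Fintype.card_pos_iff.mpr ⟨v⟩
    exact_mod_cast this
  have h6 : ((p.bypass.length : ℚ) + 1) * (Fintype.card V : ℚ) ^ 2 ≤
      Fintype.card V * (Fintype.card V : ℚ) ^ 2 := by gcongr
  have h7 : (Fintype.card V : ℚ) ^ 2 ≤ (Fintype.card V : ℚ) ^ 3 :=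
    pow_le_pow_right₀ h5 (by norm_num)
  have h8 : (Fintype.card V : ℚ) ^ 3 = Fintype.card V * (Fintype.card V : ℚ) ^ 2 := by ring
  linarith

/-- The probability that a given dart is not traversed decreases exponentially. -/
theorem survival_le (hH : ∀ v, 0 < #(nbrs H v)) (hc : H.Connected) {n : ℕ}
    (hn : Fintype.card V ≤ n) (r : ℕ) (v : V) {y z : V} (hyz : H.Adj y z) (hA : A y z) :
    survival H A (4 * n ^ 3 * r) v ≤ (1 / 2) ^ r := by
  refine survival_mul_le H A (by norm_num) (fun v => ?_) r v
  have h1 := mul_survival_le_hitTime H A (4 * n ^ 3) v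
  have h2 := hitTime_le A hH hc (4 * n ^ 3) v hyz hA
  have h3 : (Fintype.card V : ℚ) ^ 3 ≤ (n : ℚ) ^ 3 := by gcongr
  have h4 : (0 : ℚ) < n ^ 3 := by
    have := Fintype.card_pos_iff.mpr ⟨v⟩
    have : (0 : ℚ) < n := by exact_mod_cast (by omega : 0 < n)
    positivity
  push_cast at h1
  have h5 : (4 * n ^ 3 : ℚ) * survival H A (4 * n ^ 3) v ≤ 4 * n ^ 3 * (1 / 2) := by linarith
  exact le_of_mul_le_mul_left h5 (by positivity)

end RandomWalk

/-! ### Choosing the exploration sequence -/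

/-- A walk that starts with the term `a` and goes on with the terms `x`. -/
theorem PortGraph.uxsWalk_cons {V : Type} (G : PortGraph V) (a : ℕ) (x : ℕ → ℕ) (s : V × ℕ) (k : ℕ) :
    G.uxsWalk (fun k => Nat.casesOn k a x) s (k + 1) =
      G.uxsWalk x (G.cross s ((s.2 + a) % G.deg s.1)) k := by
  induction k with
  | zero => rfl
  | succ k ih => rw [PortGraph.uxsWalk, ih]; rfl

theorem PortGraph.card_nbrs {V : Type} [Fintype V] (G : PortGraph V) (v : V) :
    (nbrs G.graph v).card = G.deg v := by
  classical
  rw [← Fintype.card_fin (G.deg v), Fintype.card_congr (G.port v)]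
  exact (Fintype.card_of_subtype _ fun w => by simp).symm

theorem PortGraph.deg_le {V : Type} [Fintype V] (G : PortGraph V) (v : V) :
    G.deg v ≤ Fintype.card V := by
  rw [← G.card_nbrs]
  exact Finset.card_le_univ _

theorem PortGraph.cross_of_lt {V : Type} (G : PortGraph V) {v : V} (p : ℕ) {q : ℕ}
    (h : q < G.deg v) : (G.cross (v, p) q).1 = (G.port v ⟨q, h⟩ : V) ∧
      (G.cross (v, p) q).2 < G.deg (G.cross (v, p) q).1 := by
  unfold PortGraph.cross
  rw [dif_pos h]
  exact ⟨rfl, Fin.is_lt _⟩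

/-- The port of entry of the node that is left has no influence. -/
theorem PortGraph.cross_eq {V : Type} (G : PortGraph V) {v : V} (p p' : ℕ) {q : ℕ}
    (h : q < G.deg v) : G.cross (v, p) q = G.cross (v, p') q := by
  unfold PortGraph.cross
  rw [dif_pos h, dif_pos h]

theorem sum_range_add_mod {d : ℕ} (F : ℕ → ℚ) (p : ℕ) :
    ∑ a ∈ Finset.range d, F ((p + a) % d) = ∑ a ∈ Finset.range d, F a := by
  induction p with
  | zero =>
    refine Finset.sum_congr rfl fun a ha => ?_
    rw [zero_add, Nat.mod_eq_of_lt (Finset.mem_range.mp ha)]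
  | succ p ih =>
    have h1 := Finset.sum_range_succ (fun a => F ((p + a) % d)) d
    have h2 := Finset.sum_range_succ' (fun a => F ((p + a) % d)) d
    simp only [Nat.add_mod_right, add_zero] at h1 h2
    rw [← ih]
    have h3 : ∀ a, p + 1 + a = p + (a + 1) := fun a => by ring
    simp only [h3]
    linarith

/-- If `x` is uniformly distributed on a range whose length is a multiple of `d`, then `(p + x) mod d`
is uniformly distributed on the `d` ports. -/
theorem sum_range_mul_add_mod (d m : ℕ) (F : ℕ → ℚ) (p : ℕ) :
    ∑ a ∈ Finset.range (d * m), F ((p + a) % d) = m * ∑ a ∈ Finset.range d, F a := by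
  induction m with
  | zero => simp
  | succ m ih =>
    rw [mul_add, mul_one, Finset.sum_range_add, ih]
    have : ∀ a, (p + (d * m + a)) % d = (p + a) % d := fun a => by
      rw [show p + (d * m + a) = p + a + d * m by ring, Nat.add_mul_mod_self_left]
    simp only [this, sum_range_add_mod]
    push_cast
    ring

/-- A connected port-numbered graph with at most `n` nodes, a current node with its port of entry,
and a dart `(y, z)` that is to be traversed. -/
structure TraversalTask (n : ℕ) where
  V : Type
  fin : Fintype V
  G : PortGraph V
  connected : G.graph.Connected
  card_le : Fintype.card V ≤ n
  node : V
  entry : ℕ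
  entry_lt : entry < G.deg node
  y : V
  z : V
  adj : G.graph.Adj y z

namespace TraversalTask

attribute [instance] TraversalTask.fin

variable {n : ℕ}

/-- The first `T` steps of the walk prescribed by `x` traverse the dart `(y, z)`. -/
def Done (q : TraversalTask n) (x : ℕ → ℕ) (T : ℕ) : Prop :=
  ∃ k < T, (q.G.uxsWalk x (q.node, q.entry) k).1 = q.y ∧
    (q.G.uxsWalk x (q.node, q.entry) (k + 1)).1 = q.z

/-- The node and port of entry after one step. -/
def target (q : TraversalTask n) (a : ℕ) : q.V × ℕ :=
  q.G.cross (q.node, q.entry) ((q.entry + a) % q.G.deg q.node)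

theorem target_lt (q : TraversalTask n) (a : ℕ) : (q.target a).2 < q.G.deg (q.target a).1 :=
  (q.G.cross_of_lt q.entry (Nat.mod_lt _ (Nat.zero_lt_of_lt q.entry_lt))).2

/-- The task that remains after one step. -/
def step (q : TraversalTask n) (a : ℕ) : TraversalTask n :=
  { q with node := (q.target a).1, entry := (q.target a).2, entry_lt := q.target_lt a }

/-- The step traverses the dart. -/
def Hit (q : TraversalTask n) (a : ℕ) : Prop := q.node = q.y ∧ (q.target a).1 = q.z

theorem done_cons {q : TraversalTask n} {a : ℕ} {x : ℕ → ℕ} {T : ℕ}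
    (h : q.Hit a ∨ (q.step a).Done x T) : q.Done (fun k => Nat.casesOn k a x) (T + 1) := by
  rcases h with h | ⟨k, hk, h1, h2⟩
  · exact ⟨0, by omega, h.1, h.2⟩
  · refine ⟨k + 1, by omega, ?_, ?_⟩
    · rw [PortGraph.uxsWalk_cons]; exact h1
    · rw [PortGraph.uxsWalk_cons]; exact h2

/-- The probability that a random walk of `t` steps does not traverse the dart. -/
noncomputable def risk (q : TraversalTask n) (t : ℕ) : ℚ :=
  survival q.G.graph (fun v w => v = q.y ∧ w = q.z) t q.node

open Classical in
/-- A uniformly distributed term in the range `n !` leads to a uniformly distributed neighbour. -/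
theorem sum_risk (q : TraversalTask n) (t : ℕ) :
    ∑ a ∈ Finset.range n.factorial, (if q.Hit a then 0 else (q.step a).risk t) =
      n.factorial * q.risk (t + 1) := by
  have hd : 0 < q.G.deg q.node := Nat.zero_lt_of_lt q.entry_lt
  obtain ⟨m, hm⟩ := Nat.dvd_factorial hd ((q.G.deg_le q.node).trans q.card_le)
  let A : q.V → q.V → Prop := fun v w => v = q.y ∧ w = q.z
  let F : q.V → ℚ := fun w => if A q.node w then 0 else survival q.G.graph A t w
  have h1 := sum_range_mul_add_mod (q.G.deg q.node) m
    (fun k => F (q.G.cross (q.node, q.entry) k).1) q.entry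
  have h2 : ∑ k ∈ Finset.range (q.G.deg q.node), F (q.G.cross (q.node, q.entry) k).1 =
      ∑ w ∈ nbrs q.G.graph q.node, F w := by
    rw [Finset.sum_range]
    rw [Finset.sum_congr rfl fun k _ => by rw [(q.G.cross_of_lt q.entry k.2).1],
      (q.G.port q.node).sum_comp (fun w => F w)]
    exact (Finset.sum_subtype _ (by simp) F).symm
  have h3 : ∑ w ∈ nbrs q.G.graph q.node, F w = q.G.deg q.node * q.risk (t + 1) := by
    have : (q.G.deg q.node : ℚ) ≠ 0 := by exact_mod_cast hd.ne'
    rw [risk, survival, q.G.card_nbrs, Finset.sum_filter]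
    field_simp
    refine Finset.sum_congr rfl fun w _ => ?_
    simp only [F, A, ite_not]
    congr
  rw [h2, h3] at h1
  rw [hm]
  push_cast
  rw [mul_comm (q.G.deg q.node : ℚ), mul_assoc, ← h1]
  refine Finset.sum_congr rfl fun a _ => ?_
  simp only [Hit, risk, step, target, F, A]
  congr

open Classical in
/-- The method of conditional expectations: some sequence leaves at most as many tasks undone as are
expected to be left undone by random walks. -/
theorem exists_sequence {ι : Type} (T : ℕ) (s : Finset ι) (q : ι → TraversalTask n) :
    ∃ x : ℕ → ℕ, ((s.filter fun c => ¬ (q c).Done x T).card : ℚ) ≤ ∑ c ∈ s, (q c).risk T := by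
  induction T generalizing s q with
  | zero =>
    refine ⟨fun _ => 0, ?_⟩
    simp only [risk, survival, Finset.sum_const, nsmul_eq_mul, mul_one]
    exact_mod_cast Finset.card_filter_le _ _
  | succ T ih =>
    obtain ⟨a, -, ha⟩ : ∃ a ∈ Finset.range n.factorial,
        ∑ c ∈ s, (if (q c).Hit a then 0 else ((q c).step a).risk T) ≤
          ∑ c ∈ s, (q c).risk (T + 1) := by
      refine Finset.exists_le_of_sum_le (by simpa using n.factorial_ne_zero) (le_of_eq ?_)
      rw [Finset.sum_comm, Finset.sum_congr rfl fun c _ => sum_risk (q c) T, ← Finset.mul_sum]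
      simp
    obtain ⟨x, hx⟩ := ih (s.filter fun c => ¬ (q c).Hit a) fun c => (q c).step a
    refine ⟨fun k => Nat.casesOn k a x, ?_⟩
    calc _ ≤ _ := Nat.cast_le.mpr (Finset.card_le_card ?_)
      _ ≤ _ := hx
      _ = _ := by rw [Finset.sum_filter]; simp only [ite_not]
      _ ≤ _ := ha
    intro c hc
    simp only [Finset.mem_filter] at hc ⊢
    have := fun h => hc.2 (done_cons h)
    tauto

/-- Finite data that determine whether a task is done by a sequence: the degrees, the nodes and ports
at the ends of the edges, the starting point, and the dart to be traversed. -/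
abbrev Code (n : ℕ) : Type :=
  (Fin n → Fin (n + 1)) × (Fin n → Fin n → Fin n × Fin n) × (Fin n × Fin n) × Fin n × Fin n

/-- `c` describes the task `q`, for some injective numbering of the nodes by `0, …, n - 1`. -/
def HasCode (q : TraversalTask n) (c : Code n) : Prop :=
  ∃ f : q.V → Fin n, Function.Injective f ∧ (∀ v, (c.1 (f v) : ℕ) = q.G.deg v) ∧
    (∀ v p (k : Fin n), (k : ℕ) < q.G.deg v → (c.2.1 (f v) k).1 = f (q.G.cross (v, p) k).1 ∧
      ((c.2.1 (f v) k).2 : ℕ) = (q.G.cross (v, p) k).2) ∧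
    c.2.2.1.1 = f q.node ∧ (c.2.2.1.2 : ℕ) = q.entry ∧ c.2.2.2 = (f q.y, f q.z)

theorem exists_hasCode (q : TraversalTask n) : ∃ c, q.HasCode c := by
  have hdeg : ∀ v, q.G.deg v ≤ n := fun v => (q.G.deg_le v).trans q.card_le
  let f : q.V → Fin n := fun v => Fin.castLE q.card_le (Fintype.equivFin q.V v)
  have hf : Function.Injective f :=
    (Fin.castLE_injective q.card_le).comp (Fintype.equivFin q.V).injective
  let g : q.V → Fin n → Fin n × Fin n := fun v k =>
    if h : (k : ℕ) < q.G.deg v then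
      (f (q.G.cross (v, 0) k).1, ⟨_, (q.G.cross_of_lt 0 h).2.trans_le (hdeg _)⟩)
    else (k, k)
  refine ⟨⟨Function.extend f (fun v => ⟨q.G.deg v, Nat.lt_succ_of_le (hdeg v)⟩) 0,
    Function.extend f g fun _ k => (k, k), (f q.node, ⟨q.entry, q.entry_lt.trans_le (hdeg _)⟩),
    f q.y, f q.z⟩, f, hf, fun v => by dsimp only; rw [hf.extend_apply], fun v p k hk => ?_, rfl, rfl, rfl⟩
  dsimp only
  rw [hf.extend_apply, q.G.cross_eq p 0 hk]
  simp only [g, dif_pos hk, and_self]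

theorem HasCode.done {q q' : TraversalTask n} {c : Code n} (h : q.HasCode c) (h' : q'.HasCode c)
    {x : ℕ → ℕ} {T : ℕ} (hd : q.Done x T) : q'.Done x T := by
  obtain ⟨f, hf, hdeg, hcross, hnode, hentry, hyz⟩ := h
  obtain ⟨f', hf', hdeg', hcross', hnode', hentry', hyz'⟩ := h'
  have hwalk : ∀ k, f (q.G.uxsWalk x (q.node, q.entry) k).1 =
        f' (q'.G.uxsWalk x (q'.node, q'.entry) k).1 ∧
      (q.G.uxsWalk x (q.node, q.entry) k).2 = (q'.G.uxsWalk x (q'.node, q'.entry) k).2 ∧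
      (q.G.uxsWalk x (q.node, q.entry) k).2 < q.G.deg (q.G.uxsWalk x (q.node, q.entry) k).1 := by
    intro k
    induction k with
    | zero => exact ⟨hnode.symm.trans hnode', hentry.symm.trans hentry', q.entry_lt⟩
    | succ k ih =>
      simp only [PortGraph.uxsWalk]
      generalize q.G.uxsWalk x (q.node, q.entry) k = s at ih
      generalize q'.G.uxsWalk x (q'.node, q'.entry) k = s' at ih
      obtain ⟨v, p⟩ := s
      obtain ⟨v', p'⟩ := s'
      obtain ⟨h1, rfl, h3⟩ := ih
      simp only at h1 h3 ⊢
      have hd : q'.G.deg v' = q.G.deg v := by rw [← hdeg', ← hdeg, h1]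
      rw [hd]
      have hlt : (p + x k) % q.G.deg v < q.G.deg v := Nat.mod_lt _ (by omega)
      generalize (p + x k) % q.G.deg v = m at hlt
      have hm : m < n := hlt.trans_le ((q.G.deg_le v).trans q.card_le)
      have e := hcross v p ⟨m, hm⟩ hlt
      have e' := hcross' v' p ⟨m, hm⟩ (by rw [hd]; exact hlt)
      rw [← h1] at e'
      exact ⟨e.1.symm.trans e'.1, e.2.symm.trans e'.2, (q.G.cross_of_lt p hlt).2⟩
  rw [hyz, Prod.mk.injEq] at hyz'
  obtain ⟨k, hk, h1, h2⟩ := hd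
  refine ⟨k, hk, hf' ?_, hf' ?_⟩
  · rw [← (hwalk k).1, h1, hyz'.1]
  · rw [← (hwalk (k + 1)).1, h2, hyz'.2]

theorem card_code_lt (n : ℕ) : Fintype.card (Code n) < 2 ^ (2 * n ^ 3 + n ^ 2 + 4 * n + 1) := by
  have h1 : n + 1 ≤ 2 ^ n := Nat.lt_two_pow_self
  have h2 : n ≤ 2 ^ n := by omega
  calc Fintype.card (Code n) = (n + 1) ^ n * (((n * n) ^ n) ^ n * (n * n * (n * n))) := by
        simp [Code]
    _ ≤ (2 ^ n) ^ n * (((2 ^ n * 2 ^ n) ^ n) ^ n * (2 ^ n * 2 ^ n * (2 ^ n * 2 ^ n))) := by gcongr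
    _ = 2 ^ (2 * n ^ 3 + n ^ 2 + 4 * n) := by
        simp only [← pow_add, ← pow_mul]
        congr 1
        ring
    _ < _ := Nat.pow_lt_pow_right one_lt_two (Nat.lt_succ_self _)

theorem risk_le (q : TraversalTask n) (r : ℕ) : q.risk (4 * n ^ 3 * r) ≤ (1 / 2) ^ r := by
  have : Nontrivial q.V := ⟨_, _, q.adj.ne⟩
  exact survival_le _ (fun v => by rw [q.G.card_nbrs]; exact q.G.deg_pos q.connected v) q.connected
    q.card_le r _ q.adj ⟨rfl, rfl⟩

end TraversalTask

/-- A length that suffices for size `n`. -/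
def uxsLength (n : ℕ) : ℕ := 4 * n ^ 3 * (2 * n ^ 3 + n ^ 2 + 4 * n + 1)

/-- Universal exploration sequences of polynomial length exist. -/
theorem exists_isUXS (n : ℕ) : ∃ x : ℕ → ℕ, IsUXS x (uxsLength n) n := by
  classical
  let s : Finset (TraversalTask.Code n) :=
    Finset.univ.filter fun c => ∃ q : TraversalTask n, q.HasCode c
  have hs : ∀ c : s, ∃ q : TraversalTask n, q.HasCode c := fun c => (Finset.mem_filter.mp c.2).2
  choose q hq using hs
  obtain ⟨x, hx⟩ := TraversalTask.exists_sequence (uxsLength n) Finset.univ q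
  refine ⟨x, ?_⟩
  have hlt : ∑ c, (q c).risk (uxsLength n) < 1 := by
    set r := 2 * n ^ 3 + n ^ 2 + 4 * n + 1 with hr
    calc ∑ c, (q c).risk (uxsLength n) ≤ ∑ _c : s, (1 / 2 : ℚ) ^ r :=
          Finset.sum_le_sum fun c _ => (q c).risk_le r
      _ = (s.card : ℚ) * (1 / 2) ^ r := by simp
      _ < 2 ^ r * (1 / 2) ^ r := by
          gcongr
          exact_mod_cast (Finset.card_le_univ s).trans_lt (TraversalTask.card_code_lt n)
      _ = 1 := by rw [← mul_pow]; norm_num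
  have hall : ∀ c, (q c).Done x (uxsLength n) := by
    have hcard := hx.trans_lt hlt
    rw [← Nat.cast_one, Nat.cast_lt, Nat.lt_one_iff, Finset.card_eq_zero] at hcard
    intro c
    by_contra hc
    have : c ∈ (∅ : Finset s) := hcard ▸ Finset.mem_filter.mpr ⟨Finset.mem_univ _, hc⟩
    simp at this
  intro V _ G hG hcard v p hp y z hyz
  let t : TraversalTask n := ⟨V, inferInstance, G, hG, hcard, v, p, hp, y, z, hyz⟩
  obtain ⟨c, hc⟩ := t.exists_hasCode
  have hcs : c ∈ s := Finset.mem_filter.mpr ⟨Finset.mem_univ _, t, hc⟩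
  obtain ⟨k, hk, h1, h2⟩ := (hq ⟨c, hcs⟩).done hc (hall ⟨c, hcs⟩)
  exact ⟨k, hk, Or.inl ⟨h1, h2⟩⟩

theorem IsUXS.mono {x : ℕ → ℕ} {u u' n n' : ℕ} (h : IsUXS x u n) (hu : u ≤ u') (hn : n' ≤ n) :
    IsUXS x u' n' := by
  intro V _ G hG hcard v p hp y z hyz
  obtain ⟨k, hk, h⟩ := h V G hG (hcard.trans hn) v p hp y z hyz
  exact ⟨k, hk.trans_le hu, h⟩

theorem le_uxsLength (n : ℕ) : n ≤ uxsLength n := by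
  rw [uxsLength]
  rcases Nat.eq_zero_or_pos n with rfl | hn
  · simp
  · calc n ≤ n ^ 3 := Nat.le_self_pow (by norm_num) n
      _ ≤ 4 * n ^ 3 := by omega
      _ ≤ _ := Nat.le_mul_of_pos_right _ (by positivity)

/-- Families of universal exploration sequences with a polynomial length function exist. For the
length `u` one takes a sequence for the largest size `n` with `uxsLength n ≤ u`. -/
theorem exists_isUXSFamily : ∃ (S : ℕ → ℕ → ℕ) (P : Polynomial ℕ),
    IsUXSFamily S (fun n => P.eval n) := by
  choose x hx using exists_isUXS
  refine ⟨fun u => x (Nat.findGreatest (fun n => uxsLength n ≤ u) u),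
    4 * Polynomial.X ^ 3 *
      (2 * Polynomial.X ^ 3 + Polynomial.X ^ 2 + 4 * Polynomial.X + 1), fun n u hu => ?_⟩
  have hu : uxsLength n ≤ u := by simpa [uxsLength] using hu
  exact (hx _).mono (Nat.findGreatest_spec (P := fun n => uxsLength n ≤ u) (Nat.zero_le u)
    (by simp [uxsLength])) (Nat.le_findGreatest ((le_uxsLength n).trans hu) hu)

theorem mainTheorem6 :
    (∃ K : ℕ, ∀ (S : ℕ → ℕ → ℕ) (P : ℕ → ℕ), IsUXSFamily S P →
      (graphRVBF S).WorksInTime (fun n c L => K * (P n * c * L) ^ 2)) ∧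
    (∀ (S : ℕ → ℕ → ℕ) (P : Polynomial ℕ), IsUXSFamily S (fun n => P.eval n) →
      ∃ Q : MvPolynomial (Fin 3) ℕ,
        (graphRVBF S).WorksInTime (fun n c L => MvPolynomial.eval ![n, c, L] Q)) ∧
    (∃ (S : ℕ → ℕ → ℕ) (P : Polynomial ℕ), IsUXSFamily S (fun n => P.eval n)) :=
  ⟨⟨2 ^ 19, fun _ _ hS => graphRVBF.worksInTime hS⟩, fun _ _ hS => exists_polynomial_time hS,
    exists_isUXSFamily⟩
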